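/- **Setting.** A radio network is a finite directed graph on $n$ nodes (undirected networks are the special case of symmetric edges), where an edge $(u,v)$ means that transmissions of $u$ reach $v$; one node $s$ is the source and holds a message $m$, a finite bit string. Time proceeds in synchronous steps. In each step every node either transmits a finite bit string of its choice or listens. A listening node receives a transmitted string if and only if exactly one of its in-neighbors transmits; with collision detection, it can moreover distinguish the case that no in-neighbor transmits (silence) from the case that at least two do (collision). The network is blind: all nodes run the same randomized protocol, with independent private randomness and a global clock, and have no identifiers and no prior knowledge of the network, of $n$, or of any distance; a node knows only whether it is the source (and then $m$), its private randomness, and its own observations so far. A node other than the source that has heard nothing but silence so far does not transmit. Broadcasting is completed within time $\tau$ if from time $\tau$ on every node outputs $m$. Write $\log x$ for $\max\{\log_2 x,1\}$. **Theorem.** In blind directed radio networks with collision detection, randomized broadcasting can be performed in $O\left(D\log\frac nD\,\log\log\log\frac nD+\log^2 n\right)$ time with high probability, where $D$ is the eccentricity of the source. Precisely: there are a single such protocol and constants $K,c>0$ and $n_0$ such that, for every $n\ge n_0$, every directed graph on $n$ nodes, every source $s$, every message $m$, and every integer $D$ such that all nodes are at directed distance at most $D$ from $s$ (for instance $D=\max_v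 \mathrm{dist}(s,v)$, or the diameter of the network if it is finite), with probability at least $1-n^{-c}$ broadcasting is completed within time $$K\left(D\log\frac nD\,\log\log\log\frac nD+\log^2 n\right).$$ -/

import Mathlib

open MeasureTheory

namespace RadioNetwork

/-- Source messages and transmitted packets are finite bit strings (of unbounded length). -/
abbrev BitString := List Bool

/-- What a node experiences in one time-step, in the model with collision detection.
`sending`: it transmitted, hence did not listen. Otherwise it listened, and none (`silence`),
exactly one (`received p`, with `p` the packet sent), or at least two (`collision`) of its
in-neighbors transmitted. -/
inductive Obs where
  | sending
  | silence
  | received (p : BitString)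
  | collision

/-- A blind randomized radio protocol. All nodes run the same code; they have no identifiers and
no information about the network (its topology, its size `n`, or any distance in it).

The local state of a node consists of
* its role: `some m` for the source, which holds the source message `m`, and `none` for all others;
* its private randomness, one sample of the probability space `(Coin, coinLaw)`;
* the list of its observations in all past time-steps, most recent first. The length of this list
  is the number of elapsed time-steps, so nodes have access to a global clock.

Actions take countably many values for each of countably many local histories, so nothing is
gained or lost compared with an infinite private tape of fair coin flips. -/
structure BlindProtocol where
  /-- the sample space of the private randomness of one node -/
  Coin : Type
  [measurableSpaceCoin : MeasurableSpace Coin]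
  /-- the law of the private randomness of one node -/
  coinLaw : Measure Coin
  [isProbabilityMeasure_coinLaw : IsProbabilityMeasure coinLaw]
  /-- the action in the next time-step: `some p` is `transmit p`, and `none` is `listen` -/
  act : (role : Option BitString) → Coin → List Obs → Option BitString
  /-- the message which the node currently believes to be the source message, if any -/
  output : (role : Option BitString) → List Obs → Option BitString
  measurableSet_act : ∀ role h a, MeasurableSet {r | act role r h = a}
  /-- A node other than the source that has heard nothing but silence so far stays inactive. -/
  inactive : ∀ r h, (∀ o ∈ h, o = Obs.silence) → act none r h = none

attribute [instance] BlindProtocol.measurableSpaceCoin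
  BlindProtocol.isProbabilityMeasure_coinLaw

section Execution

variable {V : Type*}

open Classical in
/-- The observation of `v` in a time-step in which the nodes perform the actions `a`.
An edge from `u` to `v` means that transmissions of `u` reach `v`. -/
noncomputable def observe (G : Digraph V) (a : V → Option BitString) (v : V) : Obs :=
  if a v ≠ none then Obs.sending
  else if h : ∃! u, G.Adj u v ∧ a u ≠ none then
    Obs.received ((a h.choose).get (Option.isSome_iff_ne_none.mpr h.choose_spec.1.2))
  else if ∃ u, G.Adj u v ∧ a u ≠ none then Obs.collision
  else Obs.silence

open Classical in
/-- Only the source `s` initially holds the source message `m`. -/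
noncomputable def role (s : V) (m : BitString) (v : V) : Option BitString :=
  if v = s then some m else none

/-- The local history of every node after `t` time-steps, when node `v` has randomness `ω v`. -/
noncomputable def history (A : BlindProtocol) (G : Digraph V) (s : V) (m : BitString)
    (ω : V → A.Coin) : ℕ → V → List Obs
  | 0, _ => []
  | t + 1, v =>
      observe G (fun u => A.act (role s m u) (ω u) (history A G s m ω t u)) v
        :: history A G s m ω t v

/-- After `t` time-steps, node `v` knows the source message. -/
def Informed (A : BlindProtocol) (G : Digraph V) (s : V) (m : BitString)
    (ω : V → A.Coin) (t : ℕ) (v : V) : Prop :=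
  A.output (role s m v) (history A G s m ω t v) = some m

/-- Broadcasting is completed within time `τ`: from then on, all nodes know the source message. -/
def CompletedWithin (A : BlindProtocol) (G : Digraph V) (s : V) (m : BitString)
    (ω : V → A.Coin) (τ : ℝ) : Prop :=
  ∀ t : ℕ, τ ≤ t → ∀ v, Informed A G s m ω t v

/-- The nodes draw their private randomness independently. -/
noncomputable def randomness (A : BlindProtocol) (V : Type*) [Fintype V] :
    Measure (V → A.Coin) :=
  Measure.pi fun _ => A.coinLaw

end Execution

section Distance

variable {V : Type*}

/-- There is a directed walk with exactly `k` edges from `u` to `v`. -/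
def WalkOfLength (G : Digraph V) : ℕ → V → V → Prop
  | 0, u, v => u = v
  | k + 1, u, v => ∃ w, WalkOfLength G k u w ∧ G.Adj w v

/-- The directed hop distance from `u` to `v` (`⊤` if `v` is not reachable from `u`). -/
noncomputable def dist (G : Digraph V) (u v : V) : ℕ∞ :=
  ⨅ (k : ℕ) (_ : WalkOfLength G k u v), (k : ℕ∞)

/-- The largest distance from `s` to a node of the network. -/
noncomputable def eccentricity (G : Digraph V) (s : V) : ℕ∞ :=
  ⨆ v, dist G s v

end Distance

/-- The convention `log x = max {log₂ x, 1}`. -/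
noncomputable def lg (x : ℝ) : ℝ := max (Real.logb 2 x) 1

/-- `D log (n/D) log log log (n/D) + log² n`. -/
noncomputable def timeBound (n D : ℕ) : ℝ :=
  D * lg (n / D) * lg (lg (lg (n / D))) + lg n ^ 2

end RadioNetwork

namespace RadioNetwork

/-!
The empty string first spreads from the source as a beep wave. With collision detection, a node
detects it exactly when it arrives and so learns its distance to the source. Then the source starts
phases of length `3 * 4 ^ b`, in each of which it broadcasts a packet with the message and a public
random seed `z` for every time-step of the phase. A node at distance `d` that holds the packet
transmits it with probability `exp (-r * (z / 4 ^ b) ^ 2) / 2`, where `r = 4 ^ b / (d + 2 ^ b)`.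

Consider a shortest path to a node, and the informed in-neighbors of the next node on the path.
Since all nodes with a packet use the same seed, the expected number of transmitters among them is a
function of `z`. It is at least `1 / 2` at `z = 0`, it tends to `0`, and its steps are small, so it
cannot skip the range in which a single transmission is likely. The seeds are heavy-tailed, hence
they hit this range with a probability inversely proportional to its position. Thus the next node
waits for about `√(r log N)` time-steps if there are `N` such in-neighbors. In total, over the whole
path, no more than `n` in-neighbors are involved, so by concavity the sum of the waiting times is
less than the length of the phase as soon as `4 ^ b` exceeds a large multiple of
`D log (n / D) + log² n`. An exponential moment of the remaining waiting time shows that such a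
phase fails with polynomially small probability for each node.
-/

section Trajectory

open ProbabilityTheory ENNReal

variable {Ω E α : Type*}

/-- The trajectory from `x₀` of the recursion `x (t + 1) = F (x t) (e t)` driven by the inputs
`e`. -/
def trajectory (F : α → E → α) (x₀ : α) (e : ℕ → E) : ℕ → α
  | 0 => x₀
  | t + 1 => F (trajectory F x₀ e t) (e t)

variable [MeasurableSpace Ω] [MeasurableSpace E] [MeasurableSpace α] {μ : Measure Ω}
  {F : α → E → α} {ξ : ℕ → Ω → E}

lemma exists_measurable_trajectory_eq (hF : Measurable (Function.uncurry F)) (x₀ : α) (t : ℕ) :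
    ∃ φ : (Finset.range t → E) → α,
      Measurable φ ∧ ∀ e : ℕ → E, trajectory F x₀ e t = φ fun i => e i := by
  induction t with
  | zero => exact ⟨fun _ => x₀, measurable_const, fun _ => rfl⟩
  | succ t ih =>
    obtain ⟨φ, hφ, htraj⟩ := ih
    refine ⟨fun y => F (φ fun i => y ⟨i, Finset.range_subset_range.2 t.le_succ i.2⟩)
      (y ⟨t, Finset.self_mem_range_succ t⟩),
      hF.comp ((hφ.comp (by fun_prop)).prodMk (measurable_pi_apply _)), fun e => ?_⟩
    rw [trajectory, htraj]

lemma measurable_trajectory (hF : Measurable (Function.uncurry F)) (hξ : ∀ t, Measurable (ξ t))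
    (x₀ : α) (t : ℕ) : Measurable fun ω => trajectory F x₀ (ξ · ω) t := by
  obtain ⟨φ, hφ, htraj⟩ := exists_measurable_trajectory_eq hF x₀ t
  simp_rw [htraj]
  fun_prop

lemma indepFun_trajectory (hF : Measurable (Function.uncurry F)) (hξ : ∀ t, Measurable (ξ t))
    (hind : iIndepFun ξ μ) (x₀ : α) (t : ℕ) :
    IndepFun (fun ω => trajectory F x₀ (ξ · ω) t) (ξ t) μ := by
  obtain ⟨φ, hφ, htraj⟩ := exists_measurable_trajectory_eq hF x₀ t
  simp_rw [htraj]
  have hdisj : Disjoint (Finset.range t) {t} := by simp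
  exact (hind.indepFun_finset _ _ hdisj hξ).comp hφ
    (measurable_pi_apply (⟨t, Finset.mem_singleton_self t⟩ : ({t} : Finset ℕ)))

variable {ν : Measure E} [IsProbabilityMeasure μ]

lemma lintegral_trajectory_le (hF : Measurable (Function.uncurry F)) (hξ : ∀ t, Measurable (ξ t))
    (hind : iIndepFun ξ μ) (hlaw : ∀ t, μ.map (ξ t) = ν) {x₀ : α} {W : α → ℝ≥0∞}
    (hW : Measurable W) {ρ : ℝ≥0∞}
    (hdrift : ∀ t ω, ∫⁻ e, W (F (trajectory F x₀ (ξ · ω) t) e) ∂ν ≤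
      ρ * W (trajectory F x₀ (ξ · ω) t)) (t : ℕ) :
    ∫⁻ ω, W (trajectory F x₀ (ξ · ω) t) ∂μ ≤ ρ ^ t * W x₀ := by
  have : IsProbabilityMeasure ν := hlaw 0 ▸ Measure.isProbabilityMeasure_map (hξ 0).aemeasurable
  induction t with
  | zero => simp [trajectory]
  | succ t ih =>
    set X : Ω → α := fun ω => trajectory F x₀ (ξ · ω) t
    have hX : Measurable X := measurable_trajectory hF hξ x₀ t
    have hWF : Measurable fun p : α × E => W (F p.1 p.2) := hW.comp hF
    have hprod : μ.map (fun ω => (X ω, ξ t ω)) = (μ.map X).prod ν := by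
      rw [← hlaw t]
      exact (indepFun_iff_map_prod_eq_prod_map_map hX.aemeasurable (hξ t).aemeasurable).1
        (indepFun_trajectory hF hξ hind x₀ t)
    calc ∫⁻ ω, W (F (X ω) (ξ t ω)) ∂μ
        = ∫⁻ p, W (F p.1 p.2) ∂(μ.map X).prod ν := by
          rw [← hprod, lintegral_map hWF (hX.prodMk (hξ t))]
      _ = ∫⁻ ω, ∫⁻ e, W (F (X ω) e) ∂ν ∂μ := by
          rw [lintegral_prod _ hWF.aemeasurable, lintegral_map hWF.lintegral_prod_right' hX]
      _ ≤ ∫⁻ ω, ρ * W (X ω) ∂μ := lintegral_mono (hdrift t)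
      _ = ρ * ∫⁻ ω, W (X ω) ∂μ := lintegral_const_mul _ (hW.comp hX)
      _ ≤ ρ * (ρ ^ t * W x₀) := by gcongr
      _ = ρ ^ (t + 1) * W x₀ := by ring

end Trajectory

section FitnessLevels

open ProbabilityTheory

lemma exp_neg_two_mul_le {p : ℝ} (h0 : 0 ≤ p) (h1 : p ≤ 1 / 2) : Real.exp (-(2 * p)) ≤ 1 - p := by
  have h := Real.one_sub_inv_le_log_of_pos (x := 1 - p) (by linarith)
  rw [← Real.le_log_iff_exp_le (by linarith)]
  refine le_trans ?_ h
  have h2 : (1 - p)⁻¹ ≤ 1 + 2 * p := by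
    rw [inv_le_iff_one_le_mul₀ (by linarith)]
    nlinarith
  linarith

lemma lintegral_le_of_le_of_le {E : Type*} [MeasurableSpace E] {ν : Measure E}
    [IsProbabilityMeasure ν] {f : E → ENNReal} {A : Set E} (hA : MeasurableSet A) {a b p : ℝ}
    (hb : 0 ≤ b) (hba : b ≤ a) (hp : ENNReal.ofReal p ≤ ν A)
    (hfa : ∀ e, f e ≤ ENNReal.ofReal a) (hfb : ∀ e ∈ A, f e ≤ ENNReal.ofReal b) :
    ∫⁻ e, f e ∂ν ≤ ENNReal.ofReal (a * (1 - p) + b * p) := by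
  have hp' : p ≤ ν.real A := (ENNReal.ofReal_le_iff_le_toReal (measure_ne_top ν A)).1 hp
  calc ∫⁻ e, f e ∂ν
      = ∫⁻ e in A, f e ∂ν + ∫⁻ e in Aᶜ, f e ∂ν := (lintegral_add_compl f hA).symm
    _ ≤ ENNReal.ofReal b * ν A + ENNReal.ofReal a * ν Aᶜ := by
        refine add_le_add ((setLIntegral_mono measurable_const hfb).trans_eq ?_)
          ((lintegral_mono hfa).trans_eq ?_) <;> simp
    _ = ENNReal.ofReal (a * (1 - ν.real A) + b * ν.real A) := by
        rw [← ofReal_measureReal, ← ofReal_measureReal, probReal_compl_eq_one_sub hA,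
          ← ENNReal.ofReal_mul hb, ← ENNReal.ofReal_mul (hb.trans hba),
          ← ENNReal.ofReal_add (by positivity), add_comm]
        exact mul_nonneg (hb.trans hba) (sub_nonneg.2 measureReal_le_one)
    _ ≤ ENNReal.ofReal (a * (1 - p) + b * p) := by
        refine ENNReal.ofReal_le_ofReal ?_
        nlinarith [mul_le_mul_of_nonneg_left hp' (sub_nonneg.2 hba)]

variable {E α : Type*}

/-- The potential of the state `x` at level `ℓ x ≤ d`, if leaving level `j` takes `g j` steps in
expectation; it vanishes above level `d`. -/
noncomputable def levelPotential (ℓ : α → ℕ) (d : ℕ) (g : ℕ → ℝ) (β : ℝ) (x : α) : ℝ :=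
  if ℓ x ≤ d then Real.exp (2 * β * ∑ j ∈ Finset.Icc (ℓ x) d, g j) else 0

variable {ℓ : α → ℕ} {d : ℕ} {g : ℕ → ℝ} {β : ℝ}

lemma levelPotential_nonneg (x : α) : 0 ≤ levelPotential ℓ d g β x := by
  unfold levelPotential
  positivity

lemma levelPotential_le_exp (hg : ∀ j, 0 ≤ g j) (hβ : 0 ≤ β) {x : α} {i : ℕ} (hi : i ≤ ℓ x) :
    levelPotential ℓ d g β x ≤ Real.exp (2 * β * ∑ j ∈ Finset.Icc i d, g j) := by
  unfold levelPotential
  split_ifs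
  · gcongr
    exact fun _ _ _ => hg _
  · positivity

lemma levelPotential_le_of_level_le (hg : ∀ j, 0 < g j) (hβ : 0 ≤ β) {x y : α} (hxy : ℓ x ≤ ℓ y) :
    levelPotential ℓ d g β y ≤ levelPotential ℓ d g β x := by
  unfold levelPotential
  split_ifs with hy hx
  · gcongr
    exact fun _ _ _ => (hg _).le
  · exact absurd (hxy.trans hy) hx
  · positivity
  · rfl

lemma levelPotential_le_of_level_lt (hg : ∀ j, 0 < g j) (hβ : 0 ≤ β) {x y : α} (hx : ℓ x ≤ d)
    (hxy : ℓ x < ℓ y) :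
    levelPotential ℓ d g β y ≤ levelPotential ℓ d g β x * Real.exp (-(2 * (β * g (ℓ x)))) := by
  unfold levelPotential
  rw [if_pos hx, ← Real.exp_add]
  split_ifs with hy
  · rw [Real.exp_le_exp, ← Finset.insert_Icc_succ_left_eq_Icc hx,
      Finset.sum_insert (by simp), mul_add]
    have hsub : ∑ j ∈ Finset.Icc (ℓ y) d, g j ≤ ∑ j ∈ Finset.Icc (Order.succ (ℓ x)) d, g j :=
      Finset.sum_le_sum_of_subset_of_nonneg
        (Finset.Icc_subset_Icc_left (Order.succ_le_of_lt hxy)) fun _ _ _ => (hg _).le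
    nlinarith
  · positivity

variable [MeasurableSpace E] [MeasurableSpace α] {F : α → E → α} {ν : Measure E}
  [IsProbabilityMeasure ν]

lemma lintegral_levelPotential_le (hF : Measurable (Function.uncurry F)) (hℓ : Measurable ℓ)
    (hg : ∀ j, 0 < g j) (hβ : 0 ≤ β) (hβg : ∀ j, β * g j ≤ 1 / 2) {x : α}
    (hmono : ∀ e, ℓ x ≤ ℓ (F x e))
    (hleave : ℓ x ≤ d → ENNReal.ofReal (g (ℓ x))⁻¹ ≤ ν {e | ℓ x < ℓ (F x e)}) :
    ∫⁻ e, ENNReal.ofReal (levelPotential ℓ d g β (F x e)) ∂ν ≤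
      ENNReal.ofReal (Real.exp (-β)) * ENNReal.ofReal (levelPotential ℓ d g β x) := by
  by_cases hx : ℓ x ≤ d
  swap
  · have hzero : ∀ e, levelPotential ℓ d g β (F x e) = 0 := fun e => by
      rw [levelPotential, if_neg fun h => hx ((hmono e).trans h)]
    simp [hzero]
  set Φ := levelPotential ℓ d g β x
  have hΦ : 0 ≤ Φ := levelPotential_nonneg x
  have hA : MeasurableSet {e | ℓ x < ℓ (F x e)} :=
    measurableSet_lt measurable_const (hℓ.comp (hF.comp measurable_prodMk_left))
  have hexp : Real.exp (-(2 * (β * g (ℓ x)))) ≤ 1 - β * g (ℓ x) :=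
    exp_neg_two_mul_le (mul_nonneg hβ (hg _).le) (hβg _)
  refine (lintegral_le_of_le_of_le hA (by positivity)
    (mul_le_of_le_one_right hΦ (Real.exp_le_one_iff.2 (by linarith [mul_nonneg hβ (hg (ℓ x)).le])))
    (hleave hx) (fun e => ENNReal.ofReal_le_ofReal (levelPotential_le_of_level_le hg hβ (hmono e)))
    fun e he => ENNReal.ofReal_le_ofReal (levelPotential_le_of_level_lt hg hβ hx he)).trans ?_
  rw [← ENNReal.ofReal_mul (Real.exp_pos _).le]
  refine ENNReal.ofReal_le_ofReal ?_
  calc Φ * (1 - (g (ℓ x))⁻¹) + Φ * Real.exp (-(2 * (β * g (ℓ x)))) * (g (ℓ x))⁻¹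
      ≤ Φ * (1 - (g (ℓ x))⁻¹) + Φ * (1 - β * g (ℓ x)) * (g (ℓ x))⁻¹ := by
        have := (hg (ℓ x)).le
        gcongr
    _ = (1 - β) * Φ := by
        field_simp [(hg (ℓ x)).ne']
        ring
    _ ≤ Real.exp (-β) * Φ := by
        gcongr
        exact Real.one_sub_le_exp_neg β

variable {Ω : Type*} [MeasurableSpace Ω] {μ : Measure Ω} [IsProbabilityMeasure μ] {ξ : ℕ → Ω → E}

lemma measure_level_trajectory_le (hF : Measurable (Function.uncurry F))
    (hξ : ∀ t, Measurable (ξ t)) (hind : iIndepFun ξ μ) (hlaw : ∀ t, μ.map (ξ t) = ν) {x₀ : α}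
    (hℓ : Measurable ℓ) (hg : ∀ j, 0 < g j) (hβ : 0 ≤ β) (hβg : ∀ j, β * g j ≤ 1 / 2)
    (hmono : ∀ t ω e, ℓ (trajectory F x₀ (ξ · ω) t) ≤ ℓ (F (trajectory F x₀ (ξ · ω) t) e))
    (hleave : ∀ t ω, ℓ (trajectory F x₀ (ξ · ω) t) ≤ d →
      ENNReal.ofReal (g (ℓ (trajectory F x₀ (ξ · ω) t)))⁻¹ ≤
        ν {e | ℓ (trajectory F x₀ (ξ · ω) t) < ℓ (F (trajectory F x₀ (ξ · ω) t) e)}) (t : ℕ) :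
    μ {ω | ℓ (trajectory F x₀ (ξ · ω) t) ≤ d} ≤
      ENNReal.ofReal (Real.exp (-(β * t)) * levelPotential ℓ d g β x₀) := by
  have hW : Measurable fun x => ENNReal.ofReal (levelPotential ℓ d g β x) :=
    ((measurable_of_countable fun i : ℕ => ENNReal.ofReal
      (if i ≤ d then Real.exp (2 * β * ∑ j ∈ Finset.Icc i d, g j) else 0))).comp hℓ
  calc μ {ω | ℓ (trajectory F x₀ (ξ · ω) t) ≤ d}
      ≤ μ {ω | 1 ≤ ENNReal.ofReal (levelPotential ℓ d g β (trajectory F x₀ (ξ · ω) t))} := by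
        refine measure_mono fun ω (hω : _ ≤ d) => ?_
        rw [Set.mem_ofPred_eq, ENNReal.one_le_ofReal, levelPotential, if_pos hω,
          Real.one_le_exp_iff]
        exact mul_nonneg (by positivity) (Finset.sum_nonneg fun j _ => (hg j).le)
    _ ≤ ∫⁻ ω, ENNReal.ofReal (levelPotential ℓ d g β (trajectory F x₀ (ξ · ω) t)) ∂μ := by
        exact (one_mul _).ge.trans
          (mul_meas_ge_le_lintegral (hW.comp (measurable_trajectory hF hξ x₀ t)) 1)
    _ ≤ ENNReal.ofReal (Real.exp (-β)) ^ t * ENNReal.ofReal (levelPotential ℓ d g β x₀) :=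
        lintegral_trajectory_le hF hξ hind hlaw hW (fun t ω =>
          lintegral_levelPotential_le hF hℓ hg hβ hβg (hmono t ω) (hleave t ω)) t
    _ = ENNReal.ofReal (Real.exp (-(β * t)) * levelPotential ℓ d g β x₀) := by
        rw [← ENNReal.ofReal_pow (Real.exp_pos _).le, ← ENNReal.ofReal_mul (by positivity),
          ← Real.exp_nat_mul]
        ring_nf

end FitnessLevels

section ExactlyOne

open ProbabilityTheory

lemma mul_measure_le_prod {X Y : Type*} [MeasurableSpace X] [MeasurableSpace Y] {μ : Measure X}
    {ν : Measure Y} [SFinite μ] [SFinite ν] {S : Set (X × Y)} (hS : MeasurableSet S) {B : Set Y}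
    (hB : MeasurableSet B) {q : ENNReal} (hq : ∀ y ∈ B, q ≤ μ {x | (x, y) ∈ S}) :
    q * ν B ≤ μ.prod ν S := by
  rw [Measure.prod_apply_symm hS, ← setLIntegral_const]
  exact (setLIntegral_mono' hB hq).trans (setLIntegral_le_lintegral _ _)

variable {ι Ω : Type*} [MeasurableSpace Ω] {μ : Measure Ω} {A : ι → Set Ω} {U : Finset ι}

lemma measure_only_ge [DecidableEq ι] (hA : ∀ u, MeasurableSet (A u)) (hind : iIndepSet A μ)
    (hhalf : ∀ u ∈ U, μ.real (A u) ≤ 1 / 2) {u : ι} (hu : u ∈ U) :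
    ENNReal.ofReal (μ.real (A u) * Real.exp (-(2 * ∑ w ∈ U, μ.real (A w)))) ≤
      μ (A u ∩ ⋂ w ∈ U.erase u, (A w)ᶜ) := by
  have := hind.isProbabilityMeasure
  let B : ι → Set Ω := fun w => if w = u then A w else (A w)ᶜ
  have hB : ∀ w ∈ U, MeasurableSet[MeasurableSpace.generateFrom {A w}] (B w) := fun w _ => by
    have hAw := MeasurableSpace.measurableSet_generateFrom (Set.mem_singleton (A w))
    by_cases hw : w = u
    · simpa only [B, if_pos hw] using hAw
    · simpa only [B, if_neg hw] using hAw.compl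
  have hBerase : ∀ w ∈ U.erase u, B w = (A w)ᶜ := fun w hw => if_neg (Finset.ne_of_mem_erase hw)
  have hinter : A u ∩ ⋂ w ∈ U.erase u, (A w)ᶜ = ⋂ w ∈ U, B w := by
    rw [← Finset.insert_erase hu, Finset.set_biInter_insert, Finset.erase_insert_eq_erase,
      Finset.erase_idem, Set.iInter₂_congr hBerase]
    simp only [B, if_true]
  have hprod : μ (⋂ w ∈ U, B w) =
      ENNReal.ofReal (μ.real (A u) * ∏ w ∈ U.erase u, (1 - μ.real (A w))) := by
    rw [((iIndepSet_iff_iIndep _ _).1 hind).meas_biInter hB, ← Finset.mul_prod_erase _ _ hu,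
      ENNReal.ofReal_mul measureReal_nonneg, ofReal_measureReal,
      ENNReal.ofReal_prod_of_nonneg fun w _ => sub_nonneg.2 measureReal_le_one]
    simp only [B, if_true]
    congr 1
    refine Finset.prod_congr rfl fun w hw => ?_
    rw [if_neg (Finset.ne_of_mem_erase hw), ← probReal_compl_eq_one_sub (hA w), ofReal_measureReal]
  rw [hinter, hprod]
  refine ENNReal.ofReal_le_ofReal (mul_le_mul_of_nonneg_left ?_ measureReal_nonneg)
  calc Real.exp (-(2 * ∑ w ∈ U, μ.real (A w)))
      ≤ Real.exp (∑ w ∈ U.erase u, -(2 * μ.real (A w))) := by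
        rw [Finset.sum_neg_distrib, ← Finset.mul_sum]
        gcongr
        exact Finset.erase_subset u U
    _ ≤ ∏ w ∈ U.erase u, (1 - μ.real (A w)) := by
        rw [Real.exp_sum]
        exact Finset.prod_le_prod (fun _ _ => (Real.exp_pos _).le) fun w hw =>
          exp_neg_two_mul_le measureReal_nonneg (hhalf w (Finset.mem_of_mem_erase hw))

lemma measure_existsUnique_ge (hA : ∀ u, MeasurableSet (A u)) (hind : iIndepSet A μ)
    (hhalf : ∀ u ∈ U, μ.real (A u) ≤ 1 / 2) :
    ENNReal.ofReal ((∑ u ∈ U, μ.real (A u)) * Real.exp (-(2 * ∑ u ∈ U, μ.real (A u)))) ≤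
      μ {ω | ∃! u, u ∈ U ∧ ω ∈ A u} := by
  classical
  let only : ι → Set Ω := fun u => A u ∩ ⋂ w ∈ U.erase u, (A w)ᶜ
  have hdisj : Set.PairwiseDisjoint (U : Set ι) only := fun u hu v _ huv =>
    Set.disjoint_left.2 fun ω hωu hωv => Set.mem_iInter₂.1 hωv.2 u
      (Finset.mem_erase.2 ⟨huv, hu⟩) hωu.1
  calc _ = ∑ u ∈ U, ENNReal.ofReal
        (μ.real (A u) * Real.exp (-(2 * ∑ w ∈ U, μ.real (A w)))) := by
        rw [Finset.sum_mul, ENNReal.ofReal_sum_of_nonneg fun _ _ => by positivity]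
    _ ≤ ∑ u ∈ U, μ (only u) := Finset.sum_le_sum fun u hu => measure_only_ge hA hind hhalf hu
    _ = μ (⋃ u ∈ U, only u) := (measure_biUnion_finset hdisj fun u _ =>
        (hA u).inter (Finset.measurableSet_biInter _ fun w _ => (hA w).compl)).symm
    _ ≤ μ {ω | ∃! u, u ∈ U ∧ ω ∈ A u} := by
        refine measure_mono (Set.iUnion₂_subset fun u hu ω hω => ⟨u, ⟨hu, hω.1⟩, ?_⟩)
        rintro w ⟨hw, hωw⟩
        by_contra hwu
        exact Set.mem_iInter₂.1 hω.2 w (Finset.mem_erase.2 ⟨hwu, hw⟩) hωw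

lemma iIndepSet_preimage_eval {ι : Type*} [Fintype ι] {X : ι → Type*} [∀ i, MeasurableSpace (X i)]
    (μ : ∀ i, Measure (X i)) [∀ i, IsProbabilityMeasure (μ i)] {A : ∀ i, Set (X i)}
    (hA : ∀ i, MeasurableSet (A i)) :
    iIndepSet (fun i => Function.eval i ⁻¹' A i) (Measure.pi μ) :=
  (iIndepSet_iff_meas_biInter fun i => measurable_pi_apply i (hA i)).2 fun _ =>
    (iIndepFun_pi (X := fun _ => id) fun _ => aemeasurable_id).meas_biInter
      fun i _ => ⟨A i, hA i, rfl⟩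

end ExactlyOne

section ProductSlices

open ProbabilityTheory

variable {ι κ E : Type*} [MeasurableSpace E] (ν : Measure E) [IsProbabilityMeasure ν]

lemma map_swap_infinitePi_infinitePi :
    (Measure.infinitePi fun _ : ι => Measure.infinitePi fun _ : κ => ν).map (fun ω j i => ω i j) =
      Measure.infinitePi fun _ : κ => Measure.infinitePi fun _ : ι => ν := by
  have hcurry := Measure.infinitePi_map_curry (ι := κ) (κ := ι) fun _ _ => ν
  rw [← Measure.map_infinitePi_infinitePi_of_inj (P := fun _ : ι × κ => ν) Prod.swap_injective,
    ← Measure.infinitePi_map_curry_symm fun _ _ => ν, Measure.map_map (by fun_prop) (by fun_prop),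
    Measure.map_map (by fun_prop) (by fun_prop)] at hcurry
  exact hcurry

variable [Fintype ι]

lemma map_slice (t : κ) :
    (Measure.pi fun _ : ι => Measure.infinitePi fun _ : κ => ν).map (fun ω u => ω u t) =
      Measure.pi fun _ : ι => ν := by
  rw [← Measure.infinitePi_eq_pi, ← Measure.infinitePi_eq_pi,
    Measure.infinitePi_map_pi (μ := fun _ : ι => Measure.infinitePi fun _ : κ => ν)
    (f := fun _ ω => ω t) fun _ => measurable_pi_apply t]
  simp_rw [Measure.infinitePi_map_eval]

lemma iIndepFun_slice :
    iIndepFun (fun (t : κ) (ω : ι → κ → E) u => ω u t)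
      (Measure.pi fun _ : ι => Measure.infinitePi fun _ : κ => ν) := by
  rw [iIndepFun_iff_map_fun_eq_infinitePi_map (by fun_prop)]
  simp_rw [map_slice, ← Measure.infinitePi_eq_pi]
  exact map_swap_infinitePi_infinitePi ν

end ProductSlices

section HopDistance

variable {V : Type*} {G : Digraph V} {s u v : V}

lemma dist_le_of_walkOfLength {k : ℕ} (h : WalkOfLength G k u v) : dist G u v ≤ k :=
  iInf₂_le k h

variable (G) in
/-- The directed hop distance as a natural number, with junk value `0` for nodes that are not
reachable. -/
noncomputable def hopDist (u v : V) : ℕ := (dist G u v).toNat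

lemma walkOfLength_hopDist (h : dist G u v ≠ ⊤) : WalkOfLength G (hopDist G u v) u v := by
  classical
  have hex : ∃ k, WalkOfLength G k u v := by
    by_contra! hnone
    exact h (iInf₂_eq_top.2 fun k hk => absurd hk (hnone k))
  have hdist : dist G u v = Nat.find hex := le_antisymm
    (dist_le_of_walkOfLength (Nat.find_spec hex))
    (le_iInf₂ fun k hk => Nat.cast_le.2 (Nat.find_min' hex hk))
  rw [hopDist, hdist, ENat.toNat_natCast]
  exact Nat.find_spec hex

lemma hopDist_le_of_walkOfLength {k : ℕ} (h : WalkOfLength G k u v) : hopDist G u v ≤ k :=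
  ENat.toNat_le_of_le_natCast (dist_le_of_walkOfLength h)

lemma hopDist_self (s : V) : hopDist G s s = 0 :=
  Nat.le_zero.1 (hopDist_le_of_walkOfLength (k := 0) rfl)

lemma hopDist_pos (h : dist G s v ≠ ⊤) (hv : v ≠ s) : 0 < hopDist G s v := by
  refine Nat.pos_of_ne_zero fun hzero => hv ?_
  have hwalk := walkOfLength_hopDist h
  rw [hzero] at hwalk
  exact hwalk.symm

lemma hopDist_le_succ (h : dist G s u ≠ ⊤) (huv : G.Adj u v) : hopDist G s v ≤ hopDist G s u + 1 :=
  hopDist_le_of_walkOfLength ⟨u, walkOfLength_hopDist h, huv⟩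

lemma exists_shortest_path (h : dist G s v ≠ ⊤) :
    ∃ w : ℕ → V, w (hopDist G s v) = v ∧ (∀ i ≤ hopDist G s v, hopDist G s (w i) = i) ∧
      ∀ i < hopDist G s v, G.Adj (w i) (w (i + 1)) := by
  induction hd : hopDist G s v generalizing v with
  | zero => exact ⟨fun _ => v, rfl, fun i hi => hd.trans (Nat.le_zero.1 hi).symm, by simp⟩
  | succ d ih =>
    have hwalk := walkOfLength_hopDist h
    rw [hd] at hwalk
    obtain ⟨u, hu, huv⟩ := hwalk
    have hdist_u := ne_top_of_le_ne_top (ENat.natCast_ne_top d) (dist_le_of_walkOfLength hu)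
    have hd_u : hopDist G s u = d := by
      have := hopDist_le_of_walkOfLength hu
      have := hopDist_le_succ hdist_u huv
      omega
    obtain ⟨w, hwd, hdist_w, hadj⟩ := ih hdist_u hd_u
    refine ⟨fun i => if i ≤ d then w i else v, by simp, fun i hi => ?_, fun i hi => ?_⟩
    · by_cases hid : i ≤ d
      · simp only [hid, if_true, hdist_w]
      · simp only [hid, if_false, hd]
        omega
    · rcases Nat.lt_succ_iff_lt_or_eq.1 hi with hid | rfl
      · simpa only [hid.le, Nat.succ_le_of_lt hid, if_true] using hadj i hid
      · simpa [hwd] using huv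

lemma exists_adj_hopDist_eq (h : dist G s v ≠ ⊤) (hv : v ≠ s) :
    ∃ u, G.Adj u v ∧ hopDist G s v = hopDist G s u + 1 := by
  obtain ⟨w, hw, hdist, hadj⟩ := exists_shortest_path h
  have hpos := hopDist_pos h hv
  have hpred : hopDist G s v - 1 + 1 = hopDist G s v := Nat.sub_add_cancel hpos
  refine ⟨w (hopDist G s v - 1), ?_, ?_⟩
  · simpa only [hpred, hw] using hadj (hopDist G s v - 1) (by omega)
  · rw [hdist _ (Nat.sub_le _ _), hpred]

lemma dist_ne_top_of_eccentricity_le {D : ℕ} (h : eccentricity G s ≤ D) (v : V) :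
    dist G s v ≠ ⊤ :=
  ne_top_of_le_ne_top (ENat.natCast_ne_top D) ((le_iSup (dist G s) v).trans h)

lemma hopDist_le_of_eccentricity_le {D : ℕ} (h : eccentricity G s ≤ D) (v : V) :
    hopDist G s v ≤ D :=
  ENat.toNat_le_of_le_natCast ((le_iSup (dist G s) v).trans h)

end HopDistance

section Protocol

/-- The randomness of one node for one time-step: a number for its own decision to transmit, and a
number from which the source derives public randomness. -/
abbrev Sample := unitInterval × unitInterval

/-- The rate at which nodes at distance `d` from the source back off in phase `b`. -/
noncomputable def rate (b d : ℕ) : ℝ := 4 ^ b / (d + 2 ^ b)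

/-- The probability with which informed nodes at distance `d` transmit in a time-step of phase `b`
with public seed `z`. -/
noncomputable def transmitProb (b d z : ℕ) : ℝ :=
  Real.exp (-(rate b d * ((z : ℝ) / 4 ^ b) ^ 2)) / 2

/-- A heavy-tailed public seed, obtained from a uniform random number: it is at least `z` with
probability about `4 ^ b / (4 ^ b + z)`. -/
noncomputable def seed (b : ℕ) (y : unitInterval) : ℕ := ⌊(4 : ℝ) ^ b * (1 / (y : ℝ) - 1)⌋₊

/-- The contents of a packet: a phase, a message, and the public seeds of the time-steps of that
phase. -/
abbrev Packet := ℕ × BitString × List ℕ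

/-- A bit string, never empty, representing a packet. -/
def encodePacket (q : Packet) : BitString := List.replicate (Encodable.encode q + 1) true

lemma encodePacket_ne_nil (q : Packet) : encodePacket q ≠ [] := by
  simp [encodePacket]

lemma encodePacket_injective : Function.Injective encodePacket := fun q q' h =>
  Encodable.encode_injective (by simpa [encodePacket] using congrArg List.length h)

/-- The packet that a source with message `m` and randomness `r` broadcasts in phase `b`, which
consists of the time-steps `t` with `4 ^ b ≤ t < 4 ^ (b + 1)`. -/
noncomputable def phasePacket (b : ℕ) (m : BitString) (r : ℕ → Sample) : Packet :=
  (b, m, List.ofFn fun i : Fin (3 * 4 ^ b) => seed b (r (4 ^ b + i)).2)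

open Classical in
/-- The first time-step in which something other than silence was observed, or the number of
elapsed time-steps if there is none. -/
noncomputable def firstHeard (h : List Obs) : ℕ :=
  h.reverse.findIdx fun o => decide (o ≠ Obs.silence)

lemma firstHeard_eq_length_iff {h : List Obs} :
    firstHeard h = h.length ↔ ∀ o ∈ h, o = Obs.silence := by
  rw [firstHeard, ← List.length_reverse, List.findIdx_eq_length]
  simp

lemma firstHeard_cons_of_lt {h : List Obs} (o : Obs) (hh : firstHeard h < h.length) :
    firstHeard (o :: h) = firstHeard h := by
  unfold firstHeard at hh ⊢
  rw [List.reverse_cons, List.findIdx_append, if_pos (by simpa using hh)]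

lemma firstHeard_cons_of_ne {h : List Obs} {o : Obs} (hh : firstHeard h = h.length)
    (ho : o ≠ Obs.silence) : firstHeard (o :: h) = h.length := by
  unfold firstHeard at hh ⊢
  rw [List.reverse_cons, List.findIdx_append, if_neg (by simpa using hh.ge)]
  simp [ho]

lemma firstHeard_cons_silence {h : List Obs} (hh : firstHeard h = h.length) :
    firstHeard (Obs.silence :: h) = h.length + 1 :=
  firstHeard_eq_length_iff.2 (by simpa using firstHeard_eq_length_iff.1 hh)

/-- The action in time-step `t` of a node at distance `d` that holds the packet `q`: transmit it,
with the probability determined by the public seed of that time-step. -/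
noncomputable def relay (d : ℕ) (q : Packet) (t : ℕ) (x : Sample) : Option BitString :=
  open Classical in
  if (x.1 : ℝ) < transmitProb q.1 d (q.2.2.getD (t - 4 ^ q.1) 0) then some (encodePacket q)
  else none

open Classical in
/-- The empty bit string travels as a beep wave by which the nodes learn their distances. In each
phase, the source broadcasts its packet for that phase anew. -/
noncomputable def action :
    (role : Option BitString) → (ℕ → Sample) → List Obs → Option BitString
  | some m, r, h =>
      if h.length = 0 then some []
      else relay 0 (phasePacket (Nat.log 4 h.length) m r) h.length (r h.length)
  | none, r, h =>
      if firstHeard h + 1 = h.length then some []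
      else if hq : ∃ q : Packet, q.1 = Nat.log 4 h.length ∧ Obs.received (encodePacket q) ∈ h then
        relay (firstHeard h + 1) hq.choose h.length (r h.length)
      else none

open Classical in
/-- A node outputs the message of any packet that it has received. -/
noncomputable def decodedMessage : (role : Option BitString) → List Obs → Option BitString
  | some m, _ => some m
  | none, h =>
      if hq : ∃ q : Packet, Obs.received (encodePacket q) ∈ h then some hq.choose.2.1 else none

lemma measurable_seed (b : ℕ) : Measurable (seed b) := by
  unfold seed
  fun_prop

lemma measurableSet_relay_eq (d : ℕ) (q : Packet) (t : ℕ) (a : Option BitString) :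
    MeasurableSet {r : ℕ → Sample | relay d q t (r t) = a} := by
  have hlt : MeasurableSet {r : ℕ → Sample |
      ((r t).1 : ℝ) < transmitProb q.1 d (q.2.2.getD (t - 4 ^ q.1) 0)} :=
    measurableSet_lt (by fun_prop) measurable_const
  let : MeasurableSpace (Option BitString) := ⊤
  exact Measurable.ite hlt measurable_const measurable_const (t := {a}) trivial

lemma measurableSet_phasePacket_eq (b : ℕ) (m : BitString) (q : Packet) :
    MeasurableSet {r : ℕ → Sample | phasePacket b m r = q} := by
  have hseeds : Measurable fun (r : ℕ → Sample) (i : Fin (3 * 4 ^ b)) => seed b (r (4 ^ b + i)).2 :=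
    measurable_pi_lambda _ fun i => (measurable_seed b).comp (by fun_prop)
  exact hseeds (Set.to_countable {f | (b, m, List.ofFn f) = q}).measurableSet

lemma measurableSet_action_eq (role : Option BitString) (h : List Obs) (a : Option BitString) :
    MeasurableSet {r | action role r h = a} := by
  rcases role with _ | m
  · simp only [action]
    split_ifs
    exacts [.const _, measurableSet_relay_eq .., .const _]
  · simp only [action]
    split_ifs
    · exact .const _
    set b := Nat.log 4 h.length
    set t := h.length
    have hunion : {r : ℕ → Sample | relay 0 (phasePacket b m r) t (r t) = a} =
        ⋃ q, {r | phasePacket b m r = q} ∩ {r | relay 0 q t (r t) = a} := by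
      ext r
      simp
    rw [hunion]
    exact .iUnion fun q => (measurableSet_phasePacket_eq b m q).inter (measurableSet_relay_eq ..)

/-- Broadcasting by distance-dependent back-off with public randomness. -/
noncomputable def backoffProtocol : BlindProtocol where
  Coin := ℕ → Sample
  coinLaw := Measure.infinitePi fun _ => volume
  act := action
  output := decodedMessage
  measurableSet_act := measurableSet_action_eq
  inactive := fun r h hsilent => by
    have hnot : ¬ ∃ q : Packet, q.1 = Nat.log 4 h.length ∧ Obs.received (encodePacket q) ∈ h :=
      fun ⟨q, _, hq⟩ => by simpa using hsilent _ hq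
    have hlen := firstHeard_eq_length_iff.2 hsilent
    rw [action, if_neg (by omega), dif_neg hnot]

end Protocol

section Execution

variable {V : Type*} {G : Digraph V} {s : V} {m : BitString} {ω : V → ℕ → Sample}

lemma observe_eq_silence_iff {a : V → Option BitString} {v : V} :
    observe G a v = Obs.silence ↔ a v = none ∧ ∀ u, G.Adj u v → a u = none := by
  unfold observe
  split_ifs with hv hunique hexists
  · simp [hv]
  · obtain ⟨u, hu⟩ := hunique.exists
    simpa using fun _ => ⟨u, hu⟩
  · simpa using fun _ => hexists
  · exact iff_of_true rfl ⟨not_not.1 hv, by simpa using hexists⟩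

lemma observe_eq_received_iff {a : V → Option BitString} {v : V} {p : BitString} :
    observe G a v = Obs.received p ↔
      a v = none ∧ (∃! u, G.Adj u v ∧ a u ≠ none) ∧ ∃ u, G.Adj u v ∧ a u = some p := by
  unfold observe
  split_ifs with hv hunique hexists
  · simp [hv]
  · rw [Obs.received.injEq]
    refine ⟨fun h => ⟨not_not.1 hv, hunique, _, hunique.choose_spec.1.1,
      Option.eq_some_iff_get_eq.2 ⟨_, h⟩⟩, ?_⟩
    rintro ⟨-, -, u, huv, hu⟩
    have hchoose : u = hunique.choose :=
      hunique.unique ⟨huv, by simp [hu]⟩ hunique.choose_spec.1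
    exact Option.get_of_eq_some _ (hchoose ▸ hu)
  all_goals simp [hunique]

/-- The action of node `u` in time-step `t` of the protocol. -/
noncomputable def actionAt (G : Digraph V) (s : V) (m : BitString) (ω : V → ℕ → Sample) (t : ℕ)
    (u : V) : Option BitString :=
  action (role s m u) (ω u) (history backoffProtocol G s m ω t u)

lemma history_succ (t : ℕ) (v : V) : history backoffProtocol G s m ω (t + 1) v =
    observe G (actionAt G s m ω t) v :: history backoffProtocol G s m ω t v := rfl

@[simp] lemma length_history (t : ℕ) (v : V) :
    (history backoffProtocol G s m ω t v).length = t := by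
  induction t with
  | zero => rfl
  | succ t ih => rw [history_succ, List.length_cons, ih]

lemma mem_history_of_le {t t' : ℕ} (h : t ≤ t') {v : V} {o : Obs}
    (ho : o ∈ history backoffProtocol G s m ω t v) :
    o ∈ history backoffProtocol G s m ω t' v := by
  induction t', h using Nat.le_induction with
  | base => exact ho
  | succ t' _ ih => exact List.mem_cons_of_mem _ ih

lemma role_source : role s m s = some m := if_pos rfl

lemma role_of_ne {v : V} (h : v ≠ s) : role s m v = none := if_neg h

lemma encodePacket_eq_of_relay_eq_some {d t : ℕ} {q q' : Packet} {x : Sample}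
    (h : relay d q t x = some (encodePacket q')) : q = q' := by
  rw [relay, Option.ite_none_right_eq_some, Option.some.injEq] at h
  exact encodePacket_injective h.2

lemma actionAt_eq_some_encodePacket {t : ℕ} {u : V} {q : Packet}
    (h : actionAt G s m ω t u = some (encodePacket q)) :
    (q = phasePacket q.1 m (ω s) ∧ 4 ^ q.1 ≤ t) ∨
      Obs.received (encodePacket q) ∈ history backoffProtocol G s m ω t u := by
  unfold actionAt at h
  by_cases hus : u = s
  · subst hus
    rw [role_source, action, length_history] at h
    split_ifs at h with ht
    · exact absurd (Option.some.inj h).symm (encodePacket_ne_nil q)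
    · obtain rfl := encodePacket_eq_of_relay_eq_some h
      exact .inl ⟨rfl, Nat.pow_log_le_self 4 ht⟩
  · rw [role_of_ne hus, action] at h
    split_ifs at h with _ hq
    · exact absurd (Option.some.inj h).symm (encodePacket_ne_nil q)
    · obtain rfl := encodePacket_eq_of_relay_eq_some h
      exact .inr hq.choose_spec.2

lemma eq_phasePacket_of_received {t : ℕ} {v : V} {q : Packet}
    (h : Obs.received (encodePacket q) ∈ history backoffProtocol G s m ω t v) :
    q = phasePacket q.1 m (ω s) ∧ 4 ^ q.1 < t := by
  induction t generalizing v with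
  | zero => simp [history] at h
  | succ t ih =>
    have of_mem {u : V} (hu : Obs.received (encodePacket q) ∈ history backoffProtocol G s m ω t u) :
        q = phasePacket q.1 m (ω s) ∧ 4 ^ q.1 < t + 1 := (ih hu).imp_right Nat.lt_succ_of_lt
    rw [history_succ, List.mem_cons] at h
    rcases h with hnow | hearlier
    · obtain ⟨-, -, u, -, hu⟩ := observe_eq_received_iff.1 hnow.symm
      exact (actionAt_eq_some_encodePacket hu).elim (fun h => h.imp_right Nat.lt_succ_of_le) of_mem
    · exact of_mem hearlier

lemma firstHeard_history_zero (v : V) : firstHeard (history backoffProtocol G s m ω 0 v) = 0 := rfl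

lemma actionAt_of_silent {t : ℕ} {u : V} (hu : u ≠ s)
    (h : firstHeard (history backoffProtocol G s m ω t u) = t) : actionAt G s m ω t u = none := by
  rw [actionAt, role_of_ne hu]
  exact backoffProtocol.inactive _ _ (firstHeard_eq_length_iff.1 (by rw [h, length_history]))

lemma actionAt_of_firstHeard {t : ℕ} {u : V} (hu : u ≠ s)
    (h : firstHeard (history backoffProtocol G s m ω t u) + 1 = t) :
    actionAt G s m ω t u = some [] := by
  rw [actionAt, role_of_ne hu, action, if_pos (by rw [h, length_history])]

lemma firstHeard_history (hG : ∀ v, dist G s v ≠ ⊤) (t : ℕ) {v : V} (hv : v ≠ s) :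
    firstHeard (history backoffProtocol G s m ω t v) + 1 = min (t + 1) (hopDist G s v) := by
  induction t generalizing v with
  | zero =>
    have := hopDist_pos (hG v) hv
    rw [firstHeard_history_zero]
    omega
  | succ t ih =>
    have hquiet {u : V} (hu : t < hopDist G s u) : actionAt G s m ω t u = none := by
      have hus : u ≠ s := by rintro rfl; simp [hopDist_self] at hu
      exact actionAt_of_silent hus (by have := ih hus; omega)
    have hbeep {u : V} (hu : hopDist G s u = t) : actionAt G s m ω t u = some [] := by
      by_cases hus : u = s
      · subst hus
        rw [hopDist_self] at hu
        subst hu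
        rw [actionAt, role_source, action, if_pos (length_history ..)]
      · exact actionAt_of_firstHeard hus (by have := ih hus; omega)
    have hprev := ih hv
    have hlen : (history backoffProtocol G s m ω t v).length = t := length_history ..
    rw [history_succ]
    rcases lt_trichotomy (t + 1) (hopDist G s v) with hlt | heq | hgt
    · have hsilence : observe G (actionAt G s m ω t) v = Obs.silence :=
        observe_eq_silence_iff.2 ⟨hquiet (by omega), fun u huv => hquiet (by
          have := hopDist_le_succ (hG u) huv; omega)⟩
      rw [hsilence, firstHeard_cons_silence (by omega)]
      omega
    · obtain ⟨u, huv, hu⟩ := exists_adj_hopDist_eq (hG v) hv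
      have hheard : observe G (actionAt G s m ω t) v ≠ Obs.silence := fun h => by
        simpa [hbeep (show hopDist G s u = t by omega)] using (observe_eq_silence_iff.1 h).2 u huv
      rw [firstHeard_cons_of_ne (by omega) hheard]
      omega
    · rw [firstHeard_cons_of_lt _ (by omega)]
      omega

end Execution

section Phase

variable {V : Type*} {G : Digraph V} {s : V} {m : BitString} {ω : V → ℕ → Sample} {b t : ℕ}

/-- After `t` time-steps, node `v` holds the packet of phase `b`. -/
def HasPacket (G : Digraph V) (s : V) (m : BitString) (ω : V → ℕ → Sample) (b t : ℕ) (v : V) :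
    Prop :=
  v = s ∨ Obs.received (encodePacket (phasePacket b m (ω s))) ∈ history backoffProtocol G s m ω t v

lemma HasPacket.mono {t t' : ℕ} (h : t ≤ t') {v : V} (hv : HasPacket G s m ω b t v) :
    HasPacket G s m ω b t' v :=
  hv.imp_right (mem_history_of_le h)

lemma hasPacket_phase_start_iff {v : V} : HasPacket G s m ω b (4 ^ b) v ↔ v = s :=
  ⟨fun h => h.resolve_right fun hrec => (eq_phasePacket_of_received hrec).2.false, Or.inl⟩

lemma HasPacket.informed {v : V} (h : HasPacket G s m ω b t v) :
    Informed backoffProtocol G s m ω t v := by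
  change decodedMessage (role s m v) (history backoffProtocol G s m ω t v) = some m
  by_cases hv : v = s
  · rw [hv, role_source]
    rfl
  · have hq : ∃ q : Packet, Obs.received (encodePacket q) ∈ history backoffProtocol G s m ω t v :=
      ⟨_, h.resolve_left hv⟩
    rw [role_of_ne hv, decodedMessage, dif_pos hq, (eq_phasePacket_of_received hq.choose_spec).1]
    rfl

open Classical in
lemma actionAt_of_phase (hG : ∀ v, dist G s v ≠ ⊤) (hb : 4 ^ b ≤ t) (ht : t < 4 ^ (b + 1)) {u : V}
    (hu : hopDist G s u < 4 ^ b) :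
    actionAt G s m ω t u = if HasPacket G s m ω b t u then
      relay (hopDist G s u) (phasePacket b m (ω s)) t (ω u t) else none := by
  have hlog : Nat.log 4 t = b := Nat.log_eq_of_pow_le_of_lt_pow hb ht
  by_cases hus : u = s
  · subst hus
    have ht0 : t ≠ 0 := ((Nat.pow_pos (by norm_num)).trans_le hb).ne'
    rw [if_pos (.inl rfl), actionAt, role_source, action, length_history, if_neg ht0, hlog,
      hopDist_self]
  · have hfirst := firstHeard_history (m := m) (ω := ω) hG t hus
    rw [actionAt, role_of_ne hus, action, length_history, if_neg (by omega), hlog]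
    have hpacket {q : Packet} (hq : q.1 = b ∧ Obs.received (encodePacket q) ∈
        history backoffProtocol G s m ω t u) : q = phasePacket b m (ω s) :=
      hq.1 ▸ (eq_phasePacket_of_received hq.2).1
    have hiff : (∃ q : Packet, q.1 = b ∧ Obs.received (encodePacket q) ∈
        history backoffProtocol G s m ω t u) ↔ HasPacket G s m ω b t u := by
      refine ⟨fun ⟨q, hq⟩ => .inr (hpacket hq ▸ hq.2), fun h => ⟨_, rfl, h.resolve_left hus⟩⟩
    split_ifs with hq hhas hhas
    · rw [hpacket hq.choose_spec, hfirst, min_eq_right (by omega)]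
    · exact absurd (hiff.1 hq) hhas
    · exact absurd (hiff.2 hhas) hq
    · rfl

open Classical in
lemma relay_phasePacket (d : ℕ) (r : ℕ → Sample) (x : Sample) (hb : 4 ^ b ≤ t)
    (ht : t < 4 ^ (b + 1)) :
    relay d (phasePacket b m r) t x =
      if (x.1 : ℝ) < transmitProb b d (seed b (r t).2) then some (encodePacket (phasePacket b m r))
      else none := by
  have hlt : t - 4 ^ b < 3 * 4 ^ b := by
    rw [pow_succ] at ht
    omega
  simp [relay, phasePacket, hlt, Nat.add_sub_of_le hb]

lemma hasPacket_succ_iff (hG : ∀ v, dist G s v ≠ ⊤) (hd : ∀ v, hopDist G s v < 4 ^ b)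
    (hb : 4 ^ b ≤ t) (ht : t < 4 ^ (b + 1)) {v : V} :
    HasPacket G s m ω b (t + 1) v ↔ HasPacket G s m ω b t v ∨
      ∃! u, HasPacket G s m ω b t u ∧ G.Adj u v ∧
        ((ω u t).1 : ℝ) < transmitProb b (hopDist G s u) (seed b (ω s t).2) := by
  set p := encodePacket (phasePacket b m (ω s))
  classical
  have hact (u : V) : actionAt G s m ω t u =
      if HasPacket G s m ω b t u ∧
        ((ω u t).1 : ℝ) < transmitProb b (hopDist G s u) (seed b (ω s t).2)
      then some p else none := by
    rw [actionAt_of_phase hG hb ht (hd u), relay_phasePacket _ _ _ hb ht, ite_and]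
  have hunique : (∃! u, HasPacket G s m ω b t u ∧ G.Adj u v ∧
      ((ω u t).1 : ℝ) < transmitProb b (hopDist G s u) (seed b (ω s t).2)) ↔
      ∃! u, G.Adj u v ∧ actionAt G s m ω t u ≠ none := by
    simp only [hact, ne_eq, ite_eq_right_iff, reduceCtorEq, imp_false, not_not]
    exact existsUnique_congr fun u => by tauto
  rw [hunique]
  by_cases hv : HasPacket G s m ω b t v
  · exact iff_of_true (hv.mono t.le_succ) (.inl hv)
  have hidle : actionAt G s m ω t v = none := by rw [hact, if_neg fun h => hv h.1]
  have hsent (h : ∃! u, G.Adj u v ∧ actionAt G s m ω t u ≠ none) :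
      ∃ u, G.Adj u v ∧ actionAt G s m ω t u = some p := by
    obtain ⟨u, huv, hu⟩ := h.exists
    rw [hact, ne_eq, ite_eq_right_iff, not_forall] at hu
    exact ⟨u, huv, by rw [hact, if_pos hu.1]⟩
  have hreceived : Obs.received p = observe G (actionAt G s m ω t) v ↔
      ∃! u, G.Adj u v ∧ actionAt G s m ω t u ≠ none := by
    rw [eq_comm, observe_eq_received_iff]
    exact ⟨fun h => h.2.1, fun h => ⟨hidle, h, hsent h⟩⟩
  have hrec_iff : HasPacket G s m ω b (t + 1) v ↔ HasPacket G s m ω b t v ∨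
      Obs.received p = observe G (actionAt G s m ω t) v := by
    rw [HasPacket, HasPacket, history_succ, List.mem_cons]
    tauto
  rw [hrec_iff, hreceived]

/-- One time-step of phase `b`: `x` is the set of nodes that hold the packet of the phase, and `e`
is the randomness of the time-step. -/
def phaseStep (G : Digraph V) (s : V) (b : ℕ) (x : Set V) (e : V → Sample) : Set V :=
  x ∪ {v | ∃! u, u ∈ x ∧ G.Adj u v ∧
    ((e u).1 : ℝ) < transmitProb b (hopDist G s u) (seed b (e s).2)}

/-- The set of nodes that hold the packet of phase `b` after `k` time-steps of the phase. -/
noncomputable def phaseSet (G : Digraph V) (s : V) (b : ℕ) (ω : V → ℕ → Sample) (k : ℕ) : Set V :=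
  trajectory (phaseStep G s b) {s} (fun i u => ω u (4 ^ b + i)) k

lemma mem_phaseSet_iff (hG : ∀ v, dist G s v ≠ ⊤) (hd : ∀ v, hopDist G s v < 4 ^ b) {k : ℕ}
    (hk : k ≤ 3 * 4 ^ b) (v : V) :
    v ∈ phaseSet G s b ω k ↔ HasPacket G s m ω b (4 ^ b + k) v := by
  induction k generalizing v with
  | zero => exact hasPacket_phase_start_iff.symm
  | succ k ih =>
    have ht : 4 ^ b + k < 4 ^ (b + 1) := by
      rw [pow_succ]
      omega
    rw [← add_assoc, hasPacket_succ_iff hG hd (Nat.le_add_right _ _) ht]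
    simp only [← ih (Nat.le_of_succ_le hk)]
    rfl

lemma completedWithin_of_phaseSet (hG : ∀ v, dist G s v ≠ ⊤) (hd : ∀ v, hopDist G s v < 4 ^ b)
    {τ : ℝ} (hτ : (4 : ℝ) ^ (b + 1) ≤ τ) (h : ∀ v, v ∈ phaseSet G s b ω (3 * 4 ^ b)) :
    CompletedWithin backoffProtocol G s m ω τ := by
  intro t ht v
  have hend : 4 ^ b + 3 * 4 ^ b ≤ t := by
    have : 4 ^ (b + 1) ≤ t := by exact_mod_cast hτ.trans ht
    rw [pow_succ] at this
    omega
  exact (((mem_phaseSet_iff hG hd le_rfl v).1 (h v)).mono hend).informed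

end Phase

section Window

variable {ι : Type*} {U : Finset ι} {r : ι → ℝ} {R ρ k α σ : ℝ} {N : ℕ}

lemma exp_neg_mul_add_sq_ge {r : ℝ} (hr : 0 ≤ r) (hrR : r ≤ R) (hk : 3 ≤ k)
    (hσ : 0 ≤ σ) (hstep : 3 * σ * √(R * k) ≤ 1) :
    Real.exp (-1) * (Real.exp (-(r * α ^ 2)) - Real.exp (-k)) ≤
      Real.exp (-(r * (α + σ) ^ 2)) := by
  rcases le_total k (r * α ^ 2) with hfar | hnear
  · have : Real.exp (-(r * α ^ 2)) ≤ Real.exp (-k) := by gcongr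
    exact (mul_nonpos_of_nonneg_of_nonpos (Real.exp_pos _).le (by linarith)).trans
      (Real.exp_pos _).le
  set g := √(R * k)
  have hg : g ^ 2 = R * k := Real.sq_sqrt (by nlinarith)
  have hlinear : r * α ≤ g := Real.le_sqrt_of_sq_le <| by
    calc (r * α) ^ 2 = r * (r * α ^ 2) := by ring
      _ ≤ R * k := by gcongr; exact hr.trans hrR
  have hquadratic : r ≤ g ^ 2 / 3 := by nlinarith
  have hexponent : r * (α + σ) ^ 2 ≤ r * α ^ 2 + 1 := by
    calc r * (α + σ) ^ 2 = r * α ^ 2 + (2 * (r * α) * σ + r * σ ^ 2) := by ring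
      _ ≤ r * α ^ 2 + (2 * g * σ + g ^ 2 / 3 * σ ^ 2) := by gcongr
      _ = r * α ^ 2 + (2 / 3 * (3 * σ * g) + (3 * σ * g) ^ 2 / 27) := by ring
      _ ≤ r * α ^ 2 + (2 / 3 * 1 + 1 ^ 2 / 27) := by gcongr
      _ ≤ r * α ^ 2 + 1 := by norm_num
  calc Real.exp (-1) * (Real.exp (-(r * α ^ 2)) - Real.exp (-k))
      ≤ Real.exp (-1) * Real.exp (-(r * α ^ 2)) := by
        gcongr
        linarith [Real.exp_pos (-k)]
    _ = Real.exp (-(r * α ^ 2 + 1)) := by rw [← Real.exp_add, neg_add_rev]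
    _ ≤ Real.exp (-(r * (α + σ) ^ 2)) := by gcongr

/-- The expected number of transmitters when each `u ∈ U` transmits with probability
`exp (-(r u * α ^ 2)) / 2`. -/
noncomputable def backoffSum (U : Finset ι) (r : ι → ℝ) (α : ℝ) : ℝ :=
  ∑ u ∈ U, Real.exp (-(r u * α ^ 2)) / 2

lemma half_le_backoffSum_zero (hU : U.Nonempty) : 1 / 2 ≤ backoffSum U r 0 := by
  have : (1 : ℝ) ≤ U.card := by exact_mod_cast hU.card_pos
  simp only [backoffSum, zero_pow two_ne_zero, mul_zero, neg_zero, Real.exp_zero,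
    Finset.sum_const, nsmul_eq_mul]
  linarith

lemma card_mul_exp_neg_log_add_le (hN : U.card ≤ N) (k : ℝ) :
    U.card * Real.exp (-(Real.log N + k)) ≤ Real.exp (-k) := by
  rcases U.eq_empty_or_nonempty with rfl | hU
  · simpa using (Real.exp_pos _).le
  have hNpos : (0 : ℝ) < N := by exact_mod_cast hU.card_pos.trans_le hN
  rw [neg_add, Real.exp_add, Real.exp_neg, Real.exp_log hNpos, ← mul_assoc]
  refine mul_le_of_le_one_left (Real.exp_pos _).le ?_
  rw [← div_eq_mul_inv, div_le_one hNpos]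
  exact_mod_cast hN

lemma exp_neg_three_le : Real.exp (-3) ≤ 1 / 20 := by
  have hexp : Real.exp 3 = Real.exp 1 ^ 3 := by rw [← Real.exp_nat_mul]; norm_num
  rw [Real.exp_neg, one_div, hexp]
  refine inv_anti₀ (by norm_num) ?_
  calc (20 : ℝ) ≤ 2.7182818283 ^ 3 := by norm_num
    _ ≤ Real.exp 1 ^ 3 := by gcongr; exact Real.exp_one_gt_d9.le

lemma backoffSum_lt_half (hN : U.card ≤ N) (hρ : ∀ u ∈ U, ρ ≤ r u)
    (hα : Real.log N + 3 < ρ * α ^ 2) : backoffSum U r α < 1 / 2 := by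
  have hterm {u} (hu : u ∈ U) :
      Real.exp (-(r u * α ^ 2)) / 2 ≤ Real.exp (-(Real.log N + 3)) / 2 := by
    gcongr
    exact hα.le.trans (mul_le_mul_of_nonneg_right (hρ u hu) (sq_nonneg α))
  have hsum : backoffSum U r α ≤ U.card * (Real.exp (-(Real.log N + 3)) / 2) := by
    rw [← nsmul_eq_mul]
    exact Finset.sum_le_card_nsmul U _ _ fun u hu => hterm hu
  linarith [card_mul_exp_neg_log_add_le hN 3, exp_neg_three_le]

lemma backoffSum_add_ge (hN : U.card ≤ N) (hr : ∀ u ∈ U, 0 ≤ r u) (hrR : ∀ u ∈ U, r u ≤ R)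
    (hσ : 0 ≤ σ) (hstep : 3 * σ * √(R * (Real.log N + 3)) ≤ 1) :
    Real.exp (-1) * (backoffSum U r α - 1 / 40) ≤ backoffSum U r (α + σ) := by
  have hk : 3 ≤ Real.log N + 3 := by linarith [Real.log_natCast_nonneg N]
  calc Real.exp (-1) * (backoffSum U r α - 1 / 40)
      ≤ Real.exp (-1) * (backoffSum U r α - U.card * Real.exp (-(Real.log N + 3)) / 2) := by
        refine mul_le_mul_of_nonneg_left ?_ (Real.exp_pos _).le
        linarith [card_mul_exp_neg_log_add_le hN 3, exp_neg_three_le]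
    _ = ∑ u ∈ U, Real.exp (-1) *
          (Real.exp (-(r u * α ^ 2)) - Real.exp (-(Real.log N + 3))) / 2 := by
        rw [← Finset.sum_div, ← Finset.mul_sum, Finset.sum_sub_distrib, Finset.sum_const,
          nsmul_eq_mul, backoffSum, ← Finset.sum_div]
        ring
    _ ≤ backoffSum U r (α + σ) := Finset.sum_le_sum fun u hu => by
        gcongr
        exact exp_neg_mul_add_sq_ge (hr u hu) (hrR u hu) hk hσ hstep

/-- As the back-off parameter grows in steps of `σ`, the expected number of transmitters cannot
jump over the range where a single transmission is likely. -/
lemma exists_backoffSum_window (hU : U.Nonempty) (hN : U.card ≤ N) (hρ : 0 < ρ)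
    (hr : ∀ u ∈ U, ρ ≤ r u) (hrR : ∀ u ∈ U, r u ≤ R) (hσ : 0 < σ)
    (hstep : 3 * σ * √(R * (Real.log N + 3)) ≤ 1) :
    ∃ j : ℕ, ρ * (j * σ) ^ 2 ≤ Real.log N + 3 ∧ backoffSum U r (j * σ) ≤ 1.4 ∧
      0.17 ≤ backoffSum U r ((j + 1) * σ) := by
  have hex : ∃ j : ℕ, backoffSum U r (j * σ) < 1 / 2 := by
    obtain ⟨j, hj⟩ := exists_nat_gt ((1 + (Real.log N + 3) / ρ) / σ)
    rw [div_lt_iff₀ hσ] at hj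
    have hquot : 0 ≤ (Real.log N + 3) / ρ :=
      div_nonneg (by linarith [Real.log_natCast_nonneg N]) hρ.le
    refine ⟨j, backoffSum_lt_half hN hr ?_⟩
    rw [← div_lt_iff₀' hρ]
    nlinarith
  classical
  obtain ⟨j, hj⟩ : ∃ j, Nat.find hex = j + 1 := Nat.exists_eq_succ_of_ne_zero fun h => by
    have hzero := Nat.find_spec hex
    rw [h, Nat.cast_zero, zero_mul] at hzero
    exact hzero.not_ge (half_le_backoffSum_zero hU)
  have hbefore : 1 / 2 ≤ backoffSum U r (j * σ) := not_lt.1 (Nat.find_min hex (by omega))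
  have hafter : backoffSum U r ((j + 1) * σ) < 1 / 2 := by
    have := Nat.find_spec hex
    rw [hj] at this
    exact_mod_cast this
  have hdrop :=
    backoffSum_add_ge hN (fun u hu => hρ.le.trans (hr u hu)) hrR (α := j * σ) hσ.le hstep
  rw [← add_one_mul] at hdrop
  have hinv : Real.exp (-1) * Real.exp 1 = 1 := by rw [← Real.exp_add]; simp
  have hexp_lt := Real.exp_one_lt_d9
  have hexp_neg : 0.367 ≤ Real.exp (-1) := by nlinarith [Real.exp_pos 1]
  refine ⟨j, ?_, by nlinarith, by nlinarith⟩
  by_contra! h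
  exact hbefore.not_gt (backoffSum_lt_half hN hr h)

end Window

section Seed

lemma div_add_le_one (b z : ℕ) : (4 : ℝ) ^ b / (4 ^ b + z) ≤ 1 :=
  div_le_one_of_le₀ (le_add_of_nonneg_right z.cast_nonneg) (by positivity)

lemma le_seed_iff {b z : ℕ} {y : unitInterval} (hy : (0 : ℝ) < y) :
    z ≤ seed b y ↔ (y : ℝ) ≤ 4 ^ b / (4 ^ b + z) := by
  have hnonneg : 0 ≤ (4 : ℝ) ^ b * (1 / (y : ℝ) - 1) :=
    mul_nonneg (by positivity) (sub_nonneg.2 ((one_le_div hy).2 y.2.2))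
  rw [seed, Nat.le_floor_iff hnonneg, le_div_iff₀ (by positivity), mul_sub, mul_one_div, mul_one,
    le_sub_iff_add_le, le_div_iff₀ hy]
  ring_nf

lemma volume_seed_mem_Ico_ge (b z z' : ℕ) :
    ENNReal.ofReal (4 ^ b / (4 ^ b + z) - 4 ^ b / (4 ^ b + z')) ≤
      volume {y : unitInterval | seed b y ∈ Set.Ico z z'} := by
  let threshold (z : ℕ) : unitInterval := ⟨4 ^ b / (4 ^ b + z), by positivity, div_add_le_one b z⟩
  refine (unitInterval.volume_Ioc (x := threshold z') (y := threshold z)).ge.trans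
    (measure_mono fun y hy => ?_)
  have hpos : (0 : ℝ) < y := (threshold z').2.1.trans_lt hy.1
  exact ⟨(le_seed_iff hpos).2 hy.2, not_le.1 fun h => hy.1.not_ge ((le_seed_iff hpos).1 h)⟩

lemma volume_seed_window_ge {b z l : ℕ} (hl : l ≤ 4 ^ b) :
    ENNReal.ofReal (l / 4 ^ b / (4 * (1 + ((z : ℝ) / 4 ^ b) ^ 2))) ≤
      volume {y : unitInterval | seed b y ∈ Set.Ico z (z + l)} := by
  refine le_trans (ENNReal.ofReal_le_ofReal ?_) (volume_seed_mem_Ico_ge b z (z + l))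
  set α := (z : ℝ) / 4 ^ b with hα
  set σ := (l : ℝ) / 4 ^ b with hσ
  have hσ_le : σ ≤ 1 := div_le_one_of_le₀ (by exact_mod_cast hl) (by positivity)
  have : 0 ≤ α := by positivity
  have hσ_nonneg : 0 ≤ σ := by positivity
  calc σ / (4 * (1 + α ^ 2)) ≤ σ / ((1 + α) * (1 + α + σ)) := by
        refine div_le_div_of_nonneg_left (by positivity) (by positivity) ?_
        nlinarith [sq_nonneg (α - 1)]
    _ = 1 / (1 + α) - 1 / (1 + α + σ) := by
        rw [div_sub_div _ _ (by positivity) (by positivity)]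
        ring
    _ = 4 ^ b / (4 ^ b + z) - 4 ^ b / (4 ^ b + (z + l : ℕ)) := by
        congr 1
        · rw [hα]
          field_simp
        · rw [hα, hσ]
          push_cast
          field_simp
          ring

end Seed

section Success

lemma rate_pos (b d : ℕ) : 0 < rate b d := by
  unfold rate
  positivity

lemma rate_anti (b : ℕ) : Antitone (rate b) := fun d d' h => by
  unfold rate
  gcongr

lemma half_le_rate {b d : ℕ} (h : d ≤ 4 ^ b) : 1 / 2 ≤ rate b d := by
  have hd : (d : ℝ) ≤ 4 ^ b := by exact_mod_cast h
  have h2 : (2 : ℝ) ^ b ≤ 4 ^ b := by gcongr; norm_num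
  rw [rate, le_div_iff₀ (by positivity)]
  linarith

lemma transmitProb_nonneg (b d z : ℕ) : 0 ≤ transmitProb b d z := by
  unfold transmitProb
  positivity

lemma transmitProb_anti (b d : ℕ) : Antitone (transmitProb b d) := fun z z' h => by
  have := (rate_pos b d).le
  unfold transmitProb
  gcongr

lemma transmitProb_le_half (b d z : ℕ) : transmitProb b d z ≤ 1 / 2 := by
  have := transmitProb_anti b d z.zero_le
  simpa [transmitProb] using this

lemma measurableSet_existsUnique {Ω ι : Type*} [MeasurableSpace Ω] [Countable ι] {A : ι → Set Ω}
    (hA : ∀ i, MeasurableSet (A i)) : MeasurableSet {ω | ∃! i, ω ∈ A i} :=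
  Measurable.setOf <| .exists fun i => .and (hA i).mem <| .forall fun j =>
    .imp (hA j).mem measurable_const

lemma measure_pi_existsUnique_lt_ge {ι : Type*} [Fintype ι] {U : Finset ι} {p : ι → ℝ}
    (hp : ∀ i, 0 ≤ p i) (hhalf : ∀ i, p i ≤ 1 / 2) :
    ENNReal.ofReal ((∑ i ∈ U, p i) * Real.exp (-(2 * ∑ i ∈ U, p i))) ≤
      (Measure.pi fun _ : ι => (volume : Measure unitInterval))
        {x | ∃! i, i ∈ U ∧ (x i : ℝ) < p i} := by
  let A (i : ι) : Set unitInterval := {y | (y : ℝ) < p i}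
  have hA (i : ι) : MeasurableSet (A i) := measurableSet_lt (by fun_prop) measurable_const
  have hreal (i : ι) : (Measure.pi fun _ : ι => (volume : Measure unitInterval)).real
      (Function.eval i ⁻¹' A i) = p i := by
    rw [(measurePreserving_eval _ i).measureReal_preimage (hA i).nullMeasurableSet, measureReal_def]
    exact (congrArg ENNReal.toReal (unitInterval.volume_Iio
      ⟨p i, hp i, (hhalf i).trans (by norm_num)⟩)).trans (ENNReal.toReal_ofReal (hp i))
  have h := measure_existsUnique_ge (U := U) (fun i => measurable_pi_apply i (hA i))
    (iIndepSet_preimage_eval (fun _ : ι => (volume : Measure unitInterval)) hA)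
    fun i _ => (hreal i).trans_le (hhalf i)
  simp only [hreal] at h
  exact h

lemma one_div_hundred_le_mul_exp {S : ℝ} (hlow : 0.17 ≤ S) (hhigh : S ≤ 1.4) :
    1 / 100 ≤ S * Real.exp (-(2 * S)) := by
  have hpow : (100 / 6 : ℝ)⁻¹ ≤ Real.exp (-2.8) := by
    rw [Real.exp_neg]
    refine inv_anti₀ (Real.exp_pos _)
      (le_of_pow_le_pow_left₀ (by norm_num : 5 ≠ 0) (by norm_num) ?_)
    calc Real.exp 2.8 ^ 5 = Real.exp 1 ^ 14 := by
          rw [← Real.exp_nat_mul, ← Real.exp_nat_mul]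
          norm_num
      _ ≤ 2.7182818286 ^ 14 := by gcongr; exact Real.exp_one_lt_d9.le
      _ ≤ (100 / 6) ^ 5 := by norm_num
  have : 0 ≤ S := by linarith
  calc (1 : ℝ) / 100 ≤ 0.17 * (100 / 6)⁻¹ := by norm_num
    _ ≤ S * Real.exp (-2.8) := by gcongr
    _ ≤ S * Real.exp (-(2 * S)) := by gcongr; linarith

variable {V : Type*}

lemma measurableSet_lt_transmitProb (b d : ℕ) (s u : V) :
    MeasurableSet {e : V → Sample | ((e u).1 : ℝ) < transmitProb b d (seed b (e s).2)} :=
  measurableSet_lt (by fun_prop)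
    ((measurable_of_countable (transmitProb b d)).comp ((measurable_seed b).comp (by fun_prop)))

lemma sum_transmitProb_mul (b : ℕ) (d : V → ℕ) (U : Finset V) (i l : ℕ) :
    ∑ u ∈ U, transmitProb b (d u) (i * l) =
      backoffSum U (fun u => rate b (d u)) (i * (l / 4 ^ b)) := by
  simp only [transmitProb, backoffSum, Nat.cast_mul, mul_div_assoc]

variable [Fintype V]

lemma measure_pi_existsUnique_lt_transmitProb_ge {b j l z : ℕ} {U : Finset V} {d : V → ℕ}
    (hhigh : backoffSum U (fun u => rate b (d u)) (j * (l / 4 ^ b)) ≤ 1.4)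
    (hlow : 0.17 ≤ backoffSum U (fun u => rate b (d u)) ((j + 1) * (l / 4 ^ b)))
    (hz : z ∈ Set.Ico (j * l) ((j + 1) * l)) :
    ENNReal.ofReal (1 / 100) ≤ (Measure.pi fun _ : V => (volume : Measure unitInterval))
      {x | ∃! u, u ∈ U ∧ (x u : ℝ) < transmitProb b (d u) z} := by
  have hge := Finset.sum_le_sum fun u (_ : u ∈ U) => transmitProb_anti b (d u) hz.2.le
  have hle := Finset.sum_le_sum fun u (_ : u ∈ U) => transmitProb_anti b (d u) hz.1
  rw [sum_transmitProb_mul, Nat.cast_succ] at hge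
  rw [sum_transmitProb_mul] at hle
  exact (ENNReal.ofReal_le_ofReal (one_div_hundred_le_mul_exp (hlow.trans hge)
    (hle.trans hhigh))).trans (measure_pi_existsUnique_lt_ge
    (fun u => transmitProb_nonneg b (d u) z) fun u => transmitProb_le_half b (d u) z)

/-- The public seed and the transmission decisions are independent, so it suffices to bound the
probability of a unique transmitter for each seed of a set of seeds. -/
lemma mul_volume_seed_le_volume (s : V) (U : Finset V) (b : ℕ) (d : V → ℕ) {I : Set ℕ}
    {q : ENNReal} (hq : ∀ z ∈ I, q ≤ (Measure.pi fun _ : V => (volume : Measure unitInterval))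
      {x | ∃! u, u ∈ U ∧ (x u : ℝ) < transmitProb b (d u) z}) :
    q * volume {y : unitInterval | seed b y ∈ I} ≤
      (volume : Measure (V → Sample))
        {e | ∃! u, u ∈ U ∧ ((e u).1 : ℝ) < transmitProb b (d u) (seed b (e s).2)} := by
  let μ : Measure (V → unitInterval) := volume
  let E : Set ((V → unitInterval) × (V → unitInterval)) :=
    {p | ∃! u, u ∈ U ∧ (p.1 u : ℝ) < transmitProb b (d u) (seed b (p.2 s))}
  have hsplit : MeasurePreserving
      (MeasurableEquiv.arrowProdEquivProdArrow unitInterval unitInterval V)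
      (volume : Measure (V → Sample)) (μ.prod μ) :=
    volume_measurePreserving_arrowProdEquivProdArrow unitInterval unitInterval V
  have hE : MeasurableSet E := measurableSet_existsUnique fun u => .inter (.const _) <|
    measurableSet_lt (by fun_prop) ((measurable_of_countable (transmitProb b (d u))).comp
      ((measurable_seed b).comp (by fun_prop)))
  have hI : MeasurableSet {y : unitInterval | seed b y ∈ I} :=
    measurable_seed b I.to_countable.measurableSet
  have heval : MeasurePreserving (Function.eval s) μ volume := measurePreserving_eval _ s
  calc q * volume {y : unitInterval | seed b y ∈ I}
      = q * μ (Function.eval s ⁻¹' {y | seed b y ∈ I}) := by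
        rw [heval.measure_preimage hI.nullMeasurableSet]
    _ ≤ μ.prod μ E := mul_measure_le_prod hE (measurable_pi_apply s hI) fun y =>
        hq (seed b (y s))
    _ = _ := (hsplit.measure_preimage hE.nullMeasurableSet).symm

/-- A bound for the inverse probability that a node hears from its informed in-neighbors in one
time-step of phase `b`, when there are at most `N` of them and their distances are between `d` and
`D`. -/
noncomputable def waitingTime (b d D N : ℕ) : ℝ :=
  2400 * √(rate b d * (Real.log N + 3)) * (1 + (Real.log N + 3) / rate b D)

lemma log_add_three_pos (N : ℕ) : 0 < Real.log N + 3 := by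
  linarith [Real.log_natCast_nonneg N]

lemma sqrt_rate_mul_pos (b d N : ℕ) : 0 < √(rate b d * (Real.log N + 3)) :=
  Real.sqrt_pos.2 (mul_pos (rate_pos b d) (log_add_three_pos N))

lemma waitingTime_pos (b d D N : ℕ) : 0 < waitingTime b d D N := by
  have := sqrt_rate_mul_pos b d N
  have := log_add_three_pos N
  have := rate_pos b D
  unfold waitingTime
  positivity

lemma exists_window_length {g M : ℝ} (hg : 1 ≤ g) (hgM : 3 * g ≤ M) :
    ∃ l : ℕ, 1 / (6 * g) ≤ l / M ∧ 3 * (l / M) * g ≤ 1 ∧ (l : ℝ) ≤ M := by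
  have : 0 < g := by linarith
  have hM0 : 0 < M := by linarith
  have hone : 1 ≤ M / (3 * g) := (one_le_div (by positivity)).2 hgM
  have hfloor : (⌊M / (3 * g)⌋₊ : ℝ) ≤ M / (3 * g) := Nat.floor_le (by positivity)
  refine ⟨⌊M / (3 * g)⌋₊, ?_, ?_, hfloor.trans (div_le_self hM0.le (by linarith))⟩
  · rw [le_div_iff₀ hM0]
    refine le_of_eq_of_le ?_ (Nat.div_two_lt_floor hone).le
    field_simp
    norm_num
  · calc 3 * (⌊M / (3 * g)⌋₊ / M) * g ≤ 3 * (M / (3 * g) / M) * g := by gcongr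
      _ = 1 := by field_simp

lemma volume_existsUnique_lt_transmitProb_ge (s : V) {b dmin D N : ℕ} {U : Finset V} {d : V → ℕ}
    (hU : U.Nonempty) (hN : U.card ≤ N) (hdmin : ∀ u ∈ U, dmin ≤ d u) (hD : ∀ u ∈ U, d u ≤ D)
    (hDb : D ≤ 4 ^ b) (hshort : 3 * √(rate b dmin * (Real.log N + 3)) ≤ 4 ^ b) :
    ENNReal.ofReal (waitingTime b dmin D N)⁻¹ ≤
      (volume : Measure (V → Sample))
        {e | ∃! u, u ∈ U ∧ ((e u).1 : ℝ) < transmitProb b (d u) (seed b (e s).2)} := by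
  have hdminD : dmin ≤ D := hU.elim fun u hu => (hdmin u hu).trans (hD u hu)
  have hk := log_add_three_pos N
  set g := √(rate b dmin * (Real.log N + 3)) with hg
  have hg1 : 1 ≤ g := by
    rw [hg, Real.one_le_sqrt]
    nlinarith [half_le_rate (hdminD.trans hDb), Real.log_natCast_nonneg N]
  obtain ⟨l, hl_ge, hl_step, hl_le⟩ := exists_window_length hg1 hshort
  have hσ : 0 < (l : ℝ) / 4 ^ b := lt_of_lt_of_le (by positivity) hl_ge
  obtain ⟨j, hj, hhigh, hlow⟩ := exists_backoffSum_window (r := fun u => rate b (d u)) hU hN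
    (rate_pos b D) (fun u hu => rate_anti b (hD u hu)) (fun u hu => rate_anti b (hdmin u hu))
    hσ hl_step
  have hseed (z : ℕ) (hz : z ∈ Set.Ico (j * l) (j * l + l)) :=
    measure_pi_existsUnique_lt_transmitProb_ge hhigh hlow (Nat.succ_mul j l ▸ hz)
  refine le_trans ?_ (mul_volume_seed_le_volume s U b d hseed)
  refine le_trans ?_ (mul_le_mul_right (volume_seed_window_ge (by exact_mod_cast hl_le)) _)
  rw [← ENNReal.ofReal_mul (by norm_num)]
  refine ENNReal.ofReal_le_ofReal ?_
  have hα : (((j * l : ℕ) : ℝ) / 4 ^ b) ^ 2 ≤ (Real.log N + 3) / rate b D := by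
    rw [le_div_iff₀' (rate_pos b D), Nat.cast_mul, mul_div_assoc]
    exact hj
  calc (waitingTime b dmin D N)⁻¹
      = 1 / 100 * (1 / (6 * g) / (4 * (1 + (Real.log N + 3) / rate b D))) := by
        rw [waitingTime, ← hg]
        field_simp
        norm_num
    _ ≤ 1 / 100 * (l / 4 ^ b / (4 * (1 + (((j * l : ℕ) : ℝ) / 4 ^ b) ^ 2))) := by gcongr

end Success

section PathLevel

variable {V : Type*} {G : Digraph V} {w : ℕ → V} {d : ℕ} {x y : Set V}

open Classical in
/-- The progress of the set `x` of informed nodes along the path `w 0, …, w d`: the largest index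
of a node of the path with an in-neighbor in `x`, and `d + 1` as soon as `w d` itself is in `x`. -/
noncomputable def pathLevel (G : Digraph V) (w : ℕ → V) (d : ℕ) (x : Set V) : ℕ :=
  if w d ∈ x then d + 1 else Nat.findGreatest (fun i => ∃ u ∈ x, G.Adj u (w i)) d

open Classical in
lemma pathLevel_of_notMem (h : w d ∉ x) :
    pathLevel G w d x = Nat.findGreatest (fun i => ∃ u ∈ x, G.Adj u (w i)) d :=
  if_neg h

lemma pathLevel_le_iff : pathLevel G w d x ≤ d ↔ w d ∉ x := by
  unfold pathLevel
  split_ifs with h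
  · simp [h]
  · simp [h, Nat.findGreatest_le]

lemma le_pathLevel {u : V} {i : ℕ} (hi : i ≤ d) (hu : u ∈ x) (hadj : G.Adj u (w i)) :
    i ≤ pathLevel G w d x := by
  classical
  by_cases hd : w d ∈ x
  · exact hi.trans ((Nat.lt_of_not_ge fun h => pathLevel_le_iff.1 h hd).le)
  · rw [pathLevel_of_notMem hd]
    exact Nat.le_findGreatest hi ⟨u, hu, hadj⟩

lemma pathLevel_mono : Monotone (pathLevel G w d) := fun x y h => by
  classical
  by_cases hy : w d ∈ y
  · have hlast : d < pathLevel G w d y := Nat.lt_of_not_ge fun h => pathLevel_le_iff.1 h hy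
    refine le_trans ?_ hlast
    unfold pathLevel
    split_ifs
    · rfl
    · exact (Nat.findGreatest_le d).trans d.le_succ
  · rw [pathLevel_of_notMem hy, pathLevel_of_notMem fun hx => hy (h hx)]
    exact Nat.findGreatest_mono_left (fun i ⟨u, hu, hadj⟩ => ⟨u, h hu, hadj⟩) d

lemma exists_adj_pathLevel (hx : pathLevel G w d x ≤ d) (hpos : 0 < pathLevel G w d x) :
    ∃ u ∈ x, G.Adj u (w (pathLevel G w d x)) := by
  classical
  have heq := pathLevel_of_notMem (G := G) (pathLevel_le_iff.1 hx)
  exact Nat.findGreatest_of_ne_zero heq.symm hpos.ne'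

lemma pathLevel_singleton_eq {u : V} (hx : pathLevel G w d x ≤ d) (hu : u ∈ x)
    (hadj : G.Adj u (w (pathLevel G w d x))) : pathLevel G w d {u} = pathLevel G w d x :=
  le_antisymm (pathLevel_mono (Set.singleton_subset_iff.2 hu)) (le_pathLevel hx rfl hadj)

lemma pathLevel_lt (hw : ∀ i < d, G.Adj (w i) (w (i + 1))) (hx : pathLevel G w d x ≤ d)
    (hy : w (pathLevel G w d x) ∈ y) : pathLevel G w d x < pathLevel G w d y := by
  rcases hx.lt_or_eq with hlt | heq
  · exact le_pathLevel hlt hy (hw _ hlt)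
  · rw [heq] at hy ⊢
    exact not_le.1 fun h => pathLevel_le_iff.1 h hy

lemma pathLevel_singleton_pos (hw : ∀ i < d, G.Adj (w i) (w (i + 1))) :
    0 < pathLevel G w d {w 0} := by
  rcases d.eq_zero_or_pos with rfl | hd
  · exact not_le.1 fun h => pathLevel_le_iff.1 h rfl
  · exact le_pathLevel hd rfl (hw 0 hd)

variable [Fintype V]

open Classical in
/-- The number of nodes which on their own have progress `j` along the path. The in-neighbors of
the next node of the path are among them whenever the informed nodes have progress `j`. -/
noncomputable def levelSize (G : Digraph V) (w : ℕ → V) (d j : ℕ) : ℕ :=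
  (Finset.univ.filter fun u => pathLevel G w d {u} = j).card

lemma levelSize_le_card (j : ℕ) : levelSize G w d j ≤ Fintype.card V :=
  Finset.card_le_univ _

lemma sum_levelSize_le_card (J : Finset ℕ) : ∑ j ∈ J, levelSize G w d j ≤ Fintype.card V := by
  classical
  unfold levelSize
  rw [Finset.sum_card_fiberwise_eq_card_filter]
  exact Finset.card_le_univ _

end PathLevel

section Progress

variable {V : Type*} {G : Digraph V} {s : V} {w : ℕ → V} {d b D : ℕ}

lemma measurable_phaseStep [Finite V] : Measurable (Function.uncurry (phaseStep G s b)) := by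
  refine measurable_from_prod_countable_right fun x => measurable_set_iff.2 fun v => ?_
  refine measurableSet_setOfPred.1 (.union (.const _) ?_)
  exact measurableSet_existsUnique fun u =>
    .inter (.const _) (.inter (.const _) (measurableSet_lt_transmitProb b _ s u))

lemma log_natCast_mono : Monotone fun N : ℕ => Real.log N := fun N N' h => by
  rcases N.eq_zero_or_pos with rfl | hpos
  · simpa using Real.log_natCast_nonneg N'
  · exact Real.log_le_log (by exact_mod_cast hpos) (by exact_mod_cast h)

lemma sqrt_rate_mul_mono {d d' N N' : ℕ} (hd : d' ≤ d) (hN : N ≤ N') :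
    √(rate b d * (Real.log N + 3)) ≤ √(rate b d' * (Real.log N' + 3)) := by
  have := log_add_three_pos N
  have := (rate_pos b d').le
  have := rate_anti b hd
  have := log_natCast_mono hN
  gcongr

lemma waitingTime_mono {d d' N N' : ℕ} (hd : d' ≤ d) (hN : N ≤ N') :
    waitingTime b d D N ≤ waitingTime b d' D N' := by
  have := sqrt_rate_mul_mono (b := b) hd hN
  have := log_natCast_mono hN
  have := log_add_three_pos N
  have := rate_pos b D
  unfold waitingTime
  gcongr

variable [Fintype V]

lemma volume_pathLevel_lt_phaseStep_ge (hreach : ∀ v, dist G s v ≠ ⊤) (hD : ∀ v, hopDist G s v ≤ D)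
    (hDb : D ≤ 4 ^ b) (hshort : 3 * √(rate b 0 * (Real.log (Fintype.card V) + 3)) ≤ 4 ^ b)
    (hwdist : ∀ i ≤ d, hopDist G s (w i) = i) (hw : ∀ i < d, G.Adj (w i) (w (i + 1)))
    {x : Set V} (hx : pathLevel G w d x ≤ d) (hpos : 0 < pathLevel G w d x) :
    ENNReal.ofReal
        (waitingTime b (pathLevel G w d x - 1) D (levelSize G w d (pathLevel G w d x)))⁻¹ ≤
      (volume : Measure (V → Sample))
        {e | pathLevel G w d x < pathLevel G w d (phaseStep G s b x e)} := by
  classical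
  set j := pathLevel G w d x
  let U : Finset V := Finset.univ.filter fun u => u ∈ x ∧ G.Adj u (w j)
  have hmem (u : V) : u ∈ U ↔ u ∈ x ∧ G.Adj u (w j) := Finset.mem_filter_univ u
  have hU : U.Nonempty := by
    obtain ⟨u, hu⟩ := exists_adj_pathLevel hx hpos
    exact ⟨u, (hmem u).2 hu⟩
  have hcard : U.card ≤ levelSize G w d j := Finset.card_le_card fun u hu =>
    (Finset.mem_filter_univ u).2 (pathLevel_singleton_eq hx ((hmem u).1 hu).1 ((hmem u).1 hu).2)
  have hdist (u : V) (hu : u ∈ U) : j - 1 ≤ hopDist G s u := by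
    have hle := hopDist_le_succ (hreach u) ((hmem u).1 hu).2
    rw [hwdist j hx] at hle
    omega
  refine (volume_existsUnique_lt_transmitProb_ge s hU hcard hdist (fun u _ => hD u) hDb ?_).trans
    (measure_mono fun e he => pathLevel_lt hw hx (.inr ?_))
  · exact (mul_le_mul_of_nonneg_left (sqrt_rate_mul_mono zero_le (levelSize_le_card j))
      zero_le_three).trans hshort
  · simp only [hmem, and_assoc] at he
    exact he

theorem measure_notMem_phaseSet_le (hreach : ∀ v, dist G s v ≠ ⊤) (hD : ∀ v, hopDist G s v ≤ D)
    (hDb : D ≤ 4 ^ b) (hshort : 3 * √(rate b 0 * (Real.log (Fintype.card V) + 3)) ≤ 4 ^ b)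
    {β : ℝ} (hβ : 0 ≤ β) (hβg : β * waitingTime b 0 D (Fintype.card V) ≤ 1 / 2) (v : V) :
    ∃ N : ℕ → ℕ, ∑ j ∈ Finset.Icc 1 (hopDist G s v), N j ≤ Fintype.card V ∧ ∀ k : ℕ,
      randomness backoffProtocol V {ω | v ∉ phaseSet G s b ω k} ≤ ENNReal.ofReal (Real.exp
        (2 * β * ∑ j ∈ Finset.Icc 1 (hopDist G s v), waitingTime b (j - 1) D (N j) - β * k)) := by
  obtain ⟨w, hwv, hwdist, hw⟩ := exists_shortest_path (hreach v)
  set d := hopDist G s v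
  have hw0 : w 0 = s := by
    by_contra hne
    exact (hopDist_pos (hreach (w 0)) hne).ne' (hwdist 0 d.zero_le)
  let g (j : ℕ) : ℝ := waitingTime b (j - 1) D (levelSize G w d j)
  let ξ (t : ℕ) (ω : V → ℕ → Sample) (u : V) : Sample := ω u (4 ^ b + t)
  have hg (j : ℕ) : 0 < g j := waitingTime_pos ..
  have hsource (t : ℕ) (ω : V → ℕ → Sample) :
      0 < pathLevel G w d (trajectory (phaseStep G s b) {s} (ξ · ω) t) := by
    refine (hw0 ▸ pathLevel_singleton_pos hw).trans_le (pathLevel_mono ?_)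
    exact monotone_nat_of_le_succ (f := trajectory (phaseStep G s b) {s} (ξ · ω))
      (fun t => Set.subset_union_left) t.zero_le
  have hslice := iIndepFun_slice (ι := V) (κ := ℕ) (volume : Measure Sample)
  have hlevel := measure_level_trajectory_le (ℓ := pathLevel G w d) (d := d) (x₀ := {s}) (g := g)
    (measurable_phaseStep (G := G) (s := s) (b := b)) (ξ := ξ) (fun t => by fun_prop)
    (hslice.precomp (add_right_injective (4 ^ b))) (fun t => map_slice volume (4 ^ b + t))
    (measurable_of_countable _) hg hβ
    (fun j => (mul_le_mul_of_nonneg_left (waitingTime_mono zero_le (levelSize_le_card j))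
      hβ).trans hβg)
    (fun t ω e => pathLevel_mono Set.subset_union_left)
    fun t ω hle => volume_pathLevel_lt_phaseStep_ge hreach hD hDb hshort hwdist hw hle (hsource t ω)
  refine ⟨levelSize G w d, sum_levelSize_le_card _, fun k => ?_⟩
  refine (measure_mono fun ω hω => pathLevel_le_iff.2 (hwv.symm ▸ hω)).trans
    ((hlevel k).trans (ENNReal.ofReal_le_ofReal ?_))
  rw [sub_eq_neg_add, Real.exp_add]
  gcongr
  exact levelPotential_le_exp (fun j => (hg j).le) hβ (hw0 ▸ pathLevel_singleton_pos hw)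

end Progress

section Logarithm

lemma one_le_lg (x : ℝ) : 1 ≤ lg x := le_max_right _ _

lemma lg_nonneg (x : ℝ) : 0 ≤ lg x := zero_le_one.trans (one_le_lg x)

lemma log_le_lg {x : ℝ} (hx : 0 ≤ x) : Real.log x ≤ lg x := by
  rcases le_or_gt x 1 with h | h
  · exact (Real.log_nonpos hx h).trans (lg_nonneg x)
  · exact (le_div_self (Real.log_nonneg h.le) (Real.log_pos one_lt_two)
      (by linarith [Real.log_two_lt_d9])).trans (le_max_left _ _)

lemma lg_mul_le {x y : ℝ} (hx : 0 < x) (hy : 0 < y) : lg (x * y) ≤ lg x + lg y := by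
  refine max_le ?_ (by linarith [one_le_lg x, lg_nonneg y])
  rw [Real.logb_mul hx.ne' hy.ne']
  exact add_le_add (le_max_left _ _) (le_max_left _ _)

lemma lg_mono {x y : ℝ} (hx : 0 < x) (hxy : x ≤ y) : lg x ≤ lg y :=
  max_le_max_right _ (Real.logb_le_logb_of_le one_lt_two hx hxy)

lemma lg_pow_four_le {x : ℝ} (hx : 1 ≤ x) : lg x ^ 4 ≤ 1100 * x := by
  have hlog : 0 ≤ Real.log x := Real.log_nonneg hx
  have hlg : lg x ≤ 2 * (Real.log x + 1) := by
    refine max_le ?_ (by linarith)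
    rw [Real.logb, div_le_iff₀ (Real.log_pos one_lt_two)]
    nlinarith [Real.log_two_gt_d9]
  have hexp : (Real.log x + 1) ^ 4 / (Nat.factorial 4 : ℕ) ≤ x * Real.exp 1 := by
    refine (Real.pow_div_factorial_le_exp _ (by linarith) 4).trans_eq ?_
    rw [Real.exp_add, Real.exp_log (by linarith)]
  have hfactorial : ((Nat.factorial 4 : ℕ) : ℝ) = 24 := by norm_num [Nat.factorial]
  rw [hfactorial, div_le_iff₀ (by norm_num)] at hexp
  calc lg x ^ 4 ≤ (2 * (Real.log x + 1)) ^ 4 := pow_le_pow_left₀ (lg_nonneg x) hlg 4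
    _ = 16 * (Real.log x + 1) ^ 4 := by ring
    _ ≤ 16 * (x * 2.7182818286 * 24) := by grw [hexp, Real.exp_one_lt_d9.le]
    _ ≤ 1100 * x := by linarith

/-- The running time of the protocol, up to a constant factor. -/
noncomputable def timeScale (n D : ℕ) : ℝ := D * lg (n / D) + lg n ^ 2

lemma one_le_timeScale (n D : ℕ) : 1 ≤ timeScale n D := by
  have := lg_nonneg ((n : ℝ) / D)
  have := one_le_pow₀ (one_le_lg n) (n := 2)
  have : 0 ≤ (D : ℝ) * lg (n / D) := by positivity
  unfold timeScale
  linarith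

lemma timeScale_le_timeBound (n D : ℕ) : timeScale n D ≤ timeBound n D :=
  add_le_add_left (le_mul_of_one_le_right (mul_nonneg D.cast_nonneg (lg_nonneg _))
    (one_le_lg _)) _

end Logarithm

section PhaseLength

variable {n D b : ℕ}

lemma two_pow_sq (b : ℕ) : ((2 : ℝ) ^ b) ^ 2 = 4 ^ b := by
  rw [← pow_mul, mul_comm, pow_mul]
  norm_num

lemma mul_lg_div_le (hb : (10 : ℝ) ^ 20 * timeScale n D ≤ 4 ^ b) :
    (10 : ℝ) ^ 20 * (D * lg (n / D)) ≤ 4 ^ b := by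
  refine le_trans ?_ hb
  unfold timeScale
  gcongr
  exact le_add_of_nonneg_right (sq_nonneg _)

lemma mul_le_four_pow (hb : (10 : ℝ) ^ 20 * timeScale n D ≤ 4 ^ b) :
    (10 : ℝ) ^ 20 * D ≤ 4 ^ b := by
  refine le_trans ?_ (mul_lg_div_le hb)
  gcongr
  exact le_mul_of_one_le_right D.cast_nonneg (one_le_lg _)

lemma mul_lg_le_two_pow {a : ℝ} (hb : (10 : ℝ) ^ 20 * a ^ 2 * timeScale n D ≤ 4 ^ b) :
    (10 : ℝ) ^ 10 * a * lg n ≤ 2 ^ b := by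
  refine (abs_le_of_sq_le_sq' (le_trans ?_ hb |>.trans_eq (two_pow_sq b).symm) (by positivity)).2
  calc ((10 : ℝ) ^ 10 * a * lg n) ^ 2 = 10 ^ 20 * a ^ 2 * lg n ^ 2 := by ring
    _ ≤ 10 ^ 20 * a ^ 2 * timeScale n D := by
        unfold timeScale
        gcongr
        exact le_add_of_nonneg_left (mul_nonneg D.cast_nonneg (lg_nonneg _))

lemma lg_le_two_pow (hb : (10 : ℝ) ^ 20 * timeScale n D ≤ 4 ^ b) :
    (10 : ℝ) ^ 10 * lg n ≤ 2 ^ b := by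
  simpa using mul_lg_le_two_pow (a := 1) (by simpa using hb)

lemma log_add_three_le_lg (n : ℕ) : Real.log n + 3 ≤ 4 * lg n := by
  linarith [log_le_lg n.cast_nonneg, one_le_lg n]

lemma one_add_div_rate_le {N : ℕ} (hN : N ≤ n)
    (hb : (10 : ℝ) ^ 20 * timeScale n D ≤ 4 ^ b) :
    1 + (Real.log N + 3) / rate b D ≤ 2 + (Real.log N + 3) * D / 4 ^ b := by
  have hsplit : (Real.log N + 3) / rate b D =
      (Real.log N + 3) * D / 4 ^ b + (Real.log N + 3) / 2 ^ b := by
    rw [rate, ← two_pow_sq]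
    field_simp
  have hsmall : (Real.log N + 3) / 2 ^ b ≤ 1 := by
    rw [div_le_one (by positivity)]
    linarith [log_natCast_mono hN, log_add_three_le_lg n, lg_le_two_pow hb, lg_nonneg n]
  linarith

lemma sqrt_rate_zero_le (hb : (10 : ℝ) ^ 20 * timeScale n D ≤ 4 ^ b) :
    √(rate b 0 * (Real.log n + 3)) ≤ 2 * 2 ^ b / 10 ^ 5 := by
  have hrate : rate b 0 = 2 ^ b := by
    rw [rate, ← two_pow_sq]
    field_simp
    simp
  have hlg := lg_le_two_pow hb
  refine Real.sqrt_le_iff.2 ⟨by positivity, ?_⟩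
  calc rate b 0 * (Real.log n + 3) ≤ 2 ^ b * (4 * (2 ^ b / 10 ^ 10)) := by
        rw [hrate]
        gcongr
        linarith [log_add_three_le_lg n]
    _ = (2 * 2 ^ b / 10 ^ 5) ^ 2 := by ring

lemma three_mul_sqrt_rate_le (hb : (10 : ℝ) ^ 20 * timeScale n D ≤ 4 ^ b) :
    3 * √(rate b 0 * (Real.log n + 3)) ≤ 4 ^ b := by
  have hpow : (2 : ℝ) ^ b ≤ 4 ^ b := by gcongr; norm_num
  have : (0 : ℝ) < 2 ^ b := by positivity
  linarith [sqrt_rate_zero_le hb]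

lemma mul_lg_le_of_sq_le (h : D ^ 2 ≤ n) : D * lg n ≤ 2 * (D * lg (n / D)) := by
  rcases D.eq_zero_or_pos with rfl | hD
  · simp
  have hD' : (0 : ℝ) < D := by exact_mod_cast hD
  have hle : (D : ℝ) ≤ n / D := by
    rw [le_div_iff₀ hD', ← sq]
    exact_mod_cast h
  have hlg : lg n ≤ lg (n / D) + lg D := by
    simpa [hD'.ne'] using lg_mul_le (hD'.trans_le hle) hD'
  nlinarith [lg_mono hD' hle]

lemma lg_pow_four_le_of_le_sq (hn : n ≠ 0) (h : n ≤ D ^ 2) : lg n ^ 4 ≤ 17600 * D := by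
  have hD : 1 ≤ D := Nat.one_le_iff_ne_zero.2 fun h0 => hn (by simpa [h0] using h)
  have hD' : (1 : ℝ) ≤ D := by exact_mod_cast hD
  have hlg : lg n ≤ 2 * lg D := by
    refine (lg_mono (y := D * D) (by positivity) (by exact_mod_cast h.trans_eq (sq D))).trans ?_
    exact (lg_mul_le (by linarith) (by linarith)).trans_eq (two_mul _).symm
  calc lg n ^ 4 ≤ (2 * lg D) ^ 4 := pow_le_pow_left₀ (lg_nonneg _) hlg 4
    _ = 16 * lg D ^ 4 := by ring
    _ ≤ 16 * (1100 * D) := by gcongr; exact lg_pow_four_le hD'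
    _ = 17600 * D := by ring

end PhaseLength

section WaitingTimeBounds

variable {n D b : ℕ} {a : ℝ}

lemma mul_timeScale_le_of_one_le (ha : 1 ≤ a)
    (hb : (10 : ℝ) ^ 20 * a ^ 2 * timeScale n D ≤ 4 ^ b) :
    (10 : ℝ) ^ 20 * timeScale n D ≤ 4 ^ b := by
  refine le_trans ?_ hb
  have := one_le_timeScale n D
  gcongr
  exact le_mul_of_one_le_right (by norm_num) (one_le_pow₀ ha)

lemma mul_lg_mul_le_two_pow (hn : n ≠ 0) (ha : 1 ≤ a)
    (hb : (10 : ℝ) ^ 20 * a ^ 2 * timeScale n D ≤ 4 ^ b) :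
    a * lg n * (2 + (Real.log n + 3) * D / 4 ^ b) ≤ 2 ^ b := by
  have hb' := mul_timeScale_le_of_one_le ha hb
  have hlg := one_le_lg n
  have hlog := log_add_three_le_lg n
  rcases le_total (D ^ 2) n with hDn | hDn
  · have hsmall : (Real.log n + 3) * D / 4 ^ b ≤ 1 := by
      rw [div_le_one (by positivity)]
      calc (Real.log n + 3) * D ≤ 4 * lg n * D := by gcongr
        _ = 4 * (D * lg n) := by ring
        _ ≤ 10 ^ 20 * (D * lg (n / D)) := by
            have : 0 ≤ (D : ℝ) * lg (n / D) := mul_nonneg D.cast_nonneg (lg_nonneg _)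
            linarith [mul_lg_le_of_sq_le hDn]
        _ ≤ 4 ^ b := mul_lg_div_le hb'
    calc a * lg n * (2 + (Real.log n + 3) * D / 4 ^ b) ≤ a * lg n * 10 ^ 10 := by
          gcongr
          linarith
      _ ≤ 2 ^ b := by linarith [mul_lg_le_two_pow hb]
  · have hlarge : (Real.log n + 3) * D / 4 ^ b ≤ 4 * lg n := by
      refine le_trans ?_ hlog
      rw [mul_div_assoc]
      refine mul_le_of_le_one_right (log_add_three_pos n).le (div_le_one_of_le₀ ?_ (by positivity))
      linarith [mul_le_four_pow hb', D.cast_nonneg (α := ℝ)]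
    have hsq : (6 * a * lg n ^ 2) ^ 2 ≤ ((2 : ℝ) ^ b) ^ 2 := by
      calc (6 * a * lg n ^ 2) ^ 2 = 36 * a ^ 2 * lg n ^ 4 := by ring
        _ ≤ 36 * a ^ 2 * (17600 * D) := by gcongr; exact lg_pow_four_le_of_le_sq hn hDn
        _ ≤ 10 ^ 20 * a ^ 2 * D := by nlinarith [mul_nonneg (sq_nonneg a) D.cast_nonneg (α := ℝ)]
        _ ≤ 10 ^ 20 * a ^ 2 * timeScale n D := by
            unfold timeScale
            gcongr
            nlinarith [one_le_lg (n / D), D.cast_nonneg (α := ℝ)]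
        _ ≤ (2 ^ b) ^ 2 := hb.trans_eq (two_pow_sq b).symm
    calc a * lg n * (2 + (Real.log n + 3) * D / 4 ^ b) ≤ a * lg n * (6 * lg n) := by
          gcongr
          linarith
      _ = 6 * a * lg n ^ 2 := by ring
      _ ≤ 2 ^ b := (abs_le_of_sq_le_sq' hsq (by positivity)).2

lemma mul_log_mul_waitingTime_le (hn : n ≠ 0) (ha : 1 ≤ a)
    (hb : (10 : ℝ) ^ 20 * a ^ 2 * timeScale n D ≤ 4 ^ b) :
    a * Real.log n * waitingTime b 0 D n ≤ 4 ^ b / 2 := by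
  have hb' := mul_timeScale_le_of_one_le ha hb
  have := log_add_three_pos n
  have := rate_pos b D
  have := lg_nonneg n
  calc a * Real.log n * waitingTime b 0 D n
      ≤ a * lg n * (2400 * (2 * 2 ^ b / 10 ^ 5) * (2 + (Real.log n + 3) * D / 4 ^ b)) := by
        unfold waitingTime
        grw [sqrt_rate_zero_le hb', one_add_div_rate_le le_rfl hb', log_le_lg n.cast_nonneg]
    _ = 6 / 125 * 2 ^ b * (a * lg n * (2 + (Real.log n + 3) * D / 4 ^ b)) := by ring
    _ ≤ 6 / 125 * 2 ^ b * 2 ^ b := by gcongr; exact mul_lg_mul_le_two_pow hn ha hb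
    _ = 6 / 125 * 4 ^ b := by rw [← two_pow_sq]; ring
    _ ≤ 4 ^ b / 2 := by
        have : (0 : ℝ) < 4 ^ b := by positivity
        linarith

lemma mul_sum_rpow_sub_one_le {p : ℝ} (hp0 : 0 < p) (hp1 : p ≤ 1) (d : ℕ) :
    p * ∑ j ∈ Finset.Icc 1 d, (j : ℝ) ^ (p - 1) ≤ (d : ℝ) ^ p := by
  induction d with
  | zero => simp [hp0.ne']
  | succ d ih =>
    rw [Finset.sum_Icc_succ_top (by omega), mul_add]
    have hpos : (0 : ℝ) < (d + 1 : ℕ) := by positivity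
    have hle : (d : ℝ) = (d + 1 : ℕ) * (1 + -1 / (d + 1 : ℕ)) := by
      field_simp
      push_cast
      ring
    have hneg : (-1 : ℝ) ≤ -1 / (d + 1 : ℕ) := by
      rw [le_div_iff₀ hpos]
      push_cast
      linarith [d.cast_nonneg (α := ℝ)]
    have hbernoulli := rpow_one_add_le_one_add_mul_self hneg hp0.le hp1
    have hstep : (d : ℝ) ^ p ≤ ((d + 1 : ℕ) : ℝ) ^ p - p * ((d + 1 : ℕ) : ℝ) ^ (p - 1) := by
      rw [hle, Real.mul_rpow hpos.le (by linarith), Real.rpow_sub_one hpos.ne']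
      calc ((d + 1 : ℕ) : ℝ) ^ p * (1 + -1 / (d + 1 : ℕ)) ^ p
          ≤ ((d + 1 : ℕ) : ℝ) ^ p * (1 + p * (-1 / (d + 1 : ℕ))) := by gcongr
        _ = _ := by ring
    linarith

/-- Used with `x = D / j`: the terms `(D / j) ^ (3 / 4)` have a sum over `j ≤ D` that is linear in
`D`, whereas Cauchy–Schwarz would lead to the harmonic sum of the `D / j`. -/
lemma sqrt_mul_le {x y : ℝ} (hx : 0 ≤ x) (hy : 0 ≤ y) : √x * y ≤ x ^ (3 / 4 : ℝ) + y ^ 3 := by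
  have hpq : (3 / 2 : ℝ).HolderConjugate 3 := by rw [Real.holderConjugate_iff]; norm_num
  have hx34 : √x ^ (3 / 2 : ℝ) = x ^ (3 / 4 : ℝ) := by
    rw [Real.sqrt_eq_rpow, ← Real.rpow_mul hx]
    norm_num
  have hyoung := Real.young_inequality_of_nonneg (Real.sqrt_nonneg x) hy hpq
  rw [hx34, show (3 : ℝ) = (3 : ℕ) by norm_num, Real.rpow_natCast] at hyoung
  have : 0 ≤ x ^ (3 / 4 : ℝ) := Real.rpow_nonneg hx _
  have : 0 ≤ y ^ 3 := pow_nonneg hy 3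
  norm_num at hyoung
  linarith

lemma sqrt_mul_two_add_pow_three_le {r x : ℝ} (hr : 0 ≤ r) (hx : 1 ≤ x)
    (h : r ≤ 4 + Real.log x) : (√r * (2 + r)) ^ 3 ≤ 48480 * x := by
  have hsqrt : √r ≤ 2 + r := Real.sqrt_le_iff.2 ⟨by linarith, by nlinarith⟩
  have hpow : (√r * (2 + r)) ^ 3 ≤ (6 + Real.log x) ^ 5 := by
    calc (√r * (2 + r)) ^ 3 = √r ^ 2 * √r * (2 + r) ^ 3 := by ring
      _ ≤ (2 + r) * (2 + r) * (2 + r) ^ 3 := by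
          rw [Real.sq_sqrt hr]
          gcongr
          linarith
      _ = (2 + r) ^ 5 := by ring
      _ ≤ (6 + Real.log x) ^ 5 := pow_le_pow_left₀ (by linarith) (by linarith) 5
  have hexp := Real.pow_div_factorial_le_exp (6 + Real.log x)
    (by linarith [Real.log_nonneg hx]) 5
  rw [show ((Nat.factorial 5 : ℕ) : ℝ) = 120 by norm_num [Nat.factorial],
    div_le_iff₀ (by norm_num), Real.exp_add, Real.exp_log (by linarith)] at hexp
  have hexp_six : Real.exp 6 ≤ 404 := by
    calc Real.exp 6 = Real.exp 1 ^ 6 := by rw [← Real.exp_nat_mul]; norm_num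
      _ ≤ 2.7182818286 ^ 6 := by gcongr; exact Real.exp_one_lt_d9.le
      _ ≤ 404 := by norm_num
  calc (√r * (2 + r)) ^ 3 ≤ Real.exp 6 * x * 120 := hpow.trans hexp
    _ ≤ 404 * x * 120 := by gcongr
    _ = 48480 * x := by ring

lemma rate_pred_le {j : ℕ} (hj : 1 ≤ j) : rate b (j - 1) ≤ 4 ^ b / j := by
  have : (1 : ℝ) ≤ j := by exact_mod_cast hj
  have hpow : (1 : ℝ) ≤ 2 ^ b := one_le_pow₀ one_le_two
  rw [rate, Nat.cast_pred hj]
  gcongr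
  linarith

lemma log_add_three_le {N : ℕ} (hn : n ≠ 0) (hD : D ≠ 0) :
    Real.log N + 3 ≤ lg (n / D) * (4 + Real.log (1 + N * (D / n))) := by
  have hlg := one_le_lg ((n : ℝ) / D)
  have hratio : 0 ≤ (N : ℝ) * (D / n) := by positivity
  have hlog : 0 ≤ Real.log (1 + N * (D / n)) := Real.log_nonneg (by linarith)
  have hN : Real.log N ≤ lg (n / D) + Real.log (1 + N * (D / n)) := by
    rcases N.eq_zero_or_pos with rfl | hN
    · simpa using lg_nonneg _
    calc Real.log N = Real.log (n / D * (N * (D / n))) := by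
          congr 1
          field_simp
      _ = Real.log (n / D) + Real.log (N * (D / n)) := Real.log_mul (by positivity) (by positivity)
      _ ≤ lg (n / D) + Real.log (1 + N * (D / n)) := by
          gcongr
          · exact log_le_lg (by positivity)
          · linarith
  nlinarith

end WaitingTimeBounds

section TotalWaitingTime

variable {n D b : ℕ}

lemma waitingTime_pred_le {N j : ℕ} (hN : N ≤ n) (hD : D ≠ 0) (hj : 1 ≤ j)
    (hb : (10 : ℝ) ^ 20 * timeScale n D ≤ 4 ^ b) :
    waitingTime b (j - 1) D N ≤ 2400 * √(4 ^ b * lg (n / D) / D) * (√(D / j) *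
      (√((Real.log N + 3) / lg (n / D)) * (2 + (Real.log N + 3) / lg (n / D)))) := by
  have hk := log_add_three_pos N
  have hlg : 0 < lg ((n : ℝ) / D) := one_pos.trans_le (one_le_lg _)
  have hrate := rate_pos b D
  set k := Real.log N + 3 with hk_def
  set l := lg ((n : ℝ) / D)
  have hroot : √(rate b (j - 1) * k) ≤ √(4 ^ b * l / D) * (√(D / j) * √(k / l)) := by
    rw [← Real.sqrt_mul (by positivity), ← Real.sqrt_mul (by positivity)]
    refine Real.sqrt_le_sqrt ?_
    calc rate b (j - 1) * k ≤ 4 ^ b / j * k := by gcongr; exact rate_pred_le hj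
      _ = 4 ^ b * l / D * (D / j * (k / l)) := by field_simp
  have hfactor : 1 + k / rate b D ≤ 2 + k / l := by
    refine (one_add_div_rate_le hN hb).trans ?_
    rw [add_le_add_iff_left, div_le_div_iff₀ (by positivity) hlg, mul_assoc]
    gcongr
    linarith [mul_lg_div_le hb, mul_nonneg D.cast_nonneg hlg.le]
  calc waitingTime b (j - 1) D N
      ≤ 2400 * (√(4 ^ b * l / D) * (√(D / j) * √(k / l))) * (2 + k / l) := by
        rw [waitingTime, ← hk_def]
        gcongr
    _ = _ := by ring

lemma waitingTime_pred_le_add {N j : ℕ} (hn : n ≠ 0) (hN : N ≤ n) (hD : D ≠ 0) (hj : 1 ≤ j)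
    (hb : (10 : ℝ) ^ 20 * timeScale n D ≤ 4 ^ b) :
    waitingTime b (j - 1) D N ≤ 2400 * √(4 ^ b * lg (n / D) / D) *
      ((D : ℝ) ^ (3 / 4 : ℝ) * (j : ℝ) ^ (1 / 4 - 1 : ℝ) + 48480 * (1 + N * (D / n))) := by
  have hlg : 0 < lg ((n : ℝ) / D) := one_pos.trans_le (one_le_lg _)
  have hr : 0 ≤ (Real.log N + 3) / lg (n / D) := div_nonneg (log_add_three_pos N).le hlg.le
  have hpow : ((D : ℝ) / j) ^ (3 / 4 : ℝ) = (D : ℝ) ^ (3 / 4 : ℝ) * (j : ℝ) ^ (1 / 4 - 1 : ℝ) := by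
    rw [Real.div_rpow D.cast_nonneg j.cast_nonneg, div_eq_mul_inv,
      ← Real.rpow_neg j.cast_nonneg]
    norm_num
  refine (waitingTime_pred_le hN hD hj hb).trans ?_
  gcongr
  rw [← hpow]
  refine (sqrt_mul_le (by positivity) (by positivity)).trans ?_
  gcongr
  exact sqrt_mul_two_add_pow_three_le hr (le_add_of_nonneg_right (by positivity))
    ((div_le_iff₀' hlg).2 (log_add_three_le hn hD))

lemma rpow_mul_sum_rpow_le {d : ℕ} (hd : d ≤ D) (hD : D ≠ 0) :
    (D : ℝ) ^ (3 / 4 : ℝ) * ∑ j ∈ Finset.Icc 1 d, (j : ℝ) ^ (1 / 4 - 1 : ℝ) ≤ 4 * D := by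
  have hsum := mul_sum_rpow_sub_one_le (p := 1 / 4) (by norm_num) (by norm_num) d
  have hdD : (d : ℝ) ^ (1 / 4 : ℝ) ≤ (D : ℝ) ^ (1 / 4 : ℝ) := by gcongr
  calc (D : ℝ) ^ (3 / 4 : ℝ) * ∑ j ∈ Finset.Icc 1 d, (j : ℝ) ^ (1 / 4 - 1 : ℝ)
      ≤ (D : ℝ) ^ (3 / 4 : ℝ) * (4 * (D : ℝ) ^ (1 / 4 : ℝ)) := by gcongr; linarith
    _ = 4 * (D : ℝ) ^ (3 / 4 + 1 / 4 : ℝ) := by rw [Real.rpow_add (by positivity)]; ring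
    _ = 4 * D := by norm_num

lemma sum_one_add_mul_div_le {d : ℕ} {N : ℕ → ℕ} (hn : n ≠ 0) (hd : d ≤ D)
    (hN : ∑ j ∈ Finset.Icc 1 d, N j ≤ n) :
    ∑ j ∈ Finset.Icc 1 d, (1 + (N j : ℝ) * (D / n)) ≤ 2 * D := by
  have hN' : ∑ j ∈ Finset.Icc 1 d, (N j : ℝ) ≤ n := by exact_mod_cast hN
  have hd' : (d : ℝ) ≤ D := by exact_mod_cast hd
  calc ∑ j ∈ Finset.Icc 1 d, (1 + (N j : ℝ) * (D / n))
      = d + (∑ j ∈ Finset.Icc 1 d, (N j : ℝ)) * (D / n) := by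
        simp [Finset.sum_add_distrib, Finset.sum_mul]
    _ ≤ D + n * (D / n) := by gcongr
    _ = 2 * D := by
        field_simp
        ring

lemma sqrt_mul_lg_div_mul_le (hb : (10 : ℝ) ^ 20 * timeScale n D ≤ 4 ^ b) :
    √(4 ^ b * lg (n / D) / D) * D ≤ 4 ^ b / 10 ^ 10 := by
  rcases D.eq_zero_or_pos with rfl | hD
  · simp only [Nat.cast_zero, mul_zero]
    positivity
  have hlg := lg_nonneg ((n : ℝ) / D)
  refine (abs_le_of_sq_le_sq' ?_ (by positivity)).2
  calc (√(4 ^ b * lg (n / D) / D) * D) ^ 2 = 4 ^ b * (D * lg (n / D)) := by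
        rw [mul_pow, Real.sq_sqrt (by positivity)]
        field_simp
    _ ≤ 4 ^ b * (4 ^ b / 10 ^ 20) := by
        gcongr
        rw [le_div_iff₀' (by positivity)]
        exact mul_lg_div_le hb
    _ = (4 ^ b / 10 ^ 10) ^ 2 := by ring

lemma sum_waitingTime_le {d : ℕ} {N : ℕ → ℕ} (hn : n ≠ 0) (hd : d ≤ D)
    (hN : ∑ j ∈ Finset.Icc 1 d, N j ≤ n) (hb : (10 : ℝ) ^ 20 * timeScale n D ≤ 4 ^ b) :
    ∑ j ∈ Finset.Icc 1 d, waitingTime b (j - 1) D (N j) ≤ 4 ^ b / 2 := by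
  rcases d.eq_zero_or_pos with rfl | hd0
  · rw [Finset.Icc_eq_empty (by decide), Finset.sum_empty]
    positivity
  have hD : D ≠ 0 := (hd0.trans_le hd).ne'
  set A := √(4 ^ b * lg (n / D) / D)
  calc ∑ j ∈ Finset.Icc 1 d, waitingTime b (j - 1) D (N j)
      ≤ ∑ j ∈ Finset.Icc 1 d, 2400 * A * ((D : ℝ) ^ (3 / 4 : ℝ) * (j : ℝ) ^ (1 / 4 - 1 : ℝ) +
          48480 * (1 + N j * (D / n))) := Finset.sum_le_sum fun j hj =>
        waitingTime_pred_le_add hn ((Finset.single_le_sum_of_canonicallyOrdered hj).trans hN) hD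
          (Finset.mem_Icc.1 hj).1 hb
    _ = 2400 * A * ((D : ℝ) ^ (3 / 4 : ℝ) * ∑ j ∈ Finset.Icc 1 d, (j : ℝ) ^ (1 / 4 - 1 : ℝ) +
          48480 * ∑ j ∈ Finset.Icc 1 d, (1 + (N j : ℝ) * (D / n))) := by
        rw [← Finset.mul_sum, Finset.sum_add_distrib, ← Finset.mul_sum, ← Finset.mul_sum]
    _ ≤ 2400 * A * (4 * D + 48480 * (2 * D)) := by
        grw [rpow_mul_sum_rpow_le hd hD, sum_one_add_mul_div_le hn hd hN]
    _ = 2400 * (4 + 48480 * 2) * (A * D) := by ring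
    _ ≤ 2400 * (4 + 48480 * 2) * (4 ^ b / 10 ^ 10) := by
        gcongr
        exact sqrt_mul_lg_div_mul_le hb
    _ ≤ 4 ^ b / 2 := by
        have : (0 : ℝ) < 4 ^ b := by positivity
        linarith

end TotalWaitingTime

section Completion

lemma CompletedWithin.mono {V : Type*} {A : BlindProtocol} {G : Digraph V} {s : V}
    {m : BitString} {ω : V → A.Coin} {τ τ' : ℝ}
    (h : CompletedWithin A G s m ω τ) (hτ : τ ≤ τ') : CompletedWithin A G s m ω τ' :=
  fun t ht => h t (hτ.trans ht)

variable {V : Type*} [Fintype V] {G : Digraph V} {s : V} {D b : ℕ} {a : ℝ}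

lemma measure_notMem_phaseSet_le_rpow (hD : eccentricity G s ≤ D) (ha : 1 ≤ a)
    (hb : (10 : ℝ) ^ 20 * a ^ 2 * timeScale (Fintype.card V) D ≤ 4 ^ b) (v : V) :
    randomness backoffProtocol V {ω | v ∉ phaseSet G s b ω (3 * 4 ^ b)} ≤
      ENNReal.ofReal ((Fintype.card V : ℝ) ^ (-(a + 1))) := by
  set n := Fintype.card V
  have hn : n ≠ 0 := (Fintype.card_pos_iff.2 ⟨s⟩).ne'
  have hn_pos : (0 : ℝ) < n := by positivity
  have hlog : 0 ≤ Real.log n := Real.log_natCast_nonneg n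
  have hb' := mul_timeScale_le_of_one_le ha hb
  have hDb : (D : ℝ) ≤ 4 ^ b := by
    linarith [mul_le_four_pow hb', D.cast_nonneg (α := ℝ)]
  have hβ : a * Real.log n / 4 ^ b * waitingTime b 0 D n ≤ 1 / 2 := by
    rw [div_mul_eq_mul_div, div_le_iff₀ (by positivity)]
    linarith [mul_log_mul_waitingTime_le hn ha hb]
  obtain ⟨N, hN, hfail⟩ := measure_notMem_phaseSet_le (dist_ne_top_of_eccentricity_le hD)
    (hopDist_le_of_eccentricity_le hD) (by exact_mod_cast hDb) (three_mul_sqrt_rate_le hb')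
    (by positivity) hβ v
  refine (hfail _).trans (ENNReal.ofReal_le_ofReal ?_)
  rw [Real.rpow_def_of_pos hn_pos]
  refine Real.exp_le_exp.2 ?_
  have hsum := sum_waitingTime_le hn (hopDist_le_of_eccentricity_le hD v) hN hb'
  calc _ ≤ 2 * (a * Real.log n / 4 ^ b) * (4 ^ b / 2) -
        a * Real.log n / 4 ^ b * (3 * 4 ^ b : ℕ) := by gcongr
    _ = -(2 * a * Real.log n) := by
        push_cast
        field_simp
        ring
    _ ≤ Real.log n * -(a + 1) := by nlinarith

lemma measure_not_completedWithin_le_rpow (m : BitString) (hD : eccentricity G s ≤ D) (ha : 1 ≤ a)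
    (hb : (10 : ℝ) ^ 20 * a ^ 2 * timeScale (Fintype.card V) D ≤ 4 ^ b) {τ : ℝ}
    (hτ : 4 ^ (b + 1) ≤ τ) :
    randomness backoffProtocol V {ω | ¬ CompletedWithin backoffProtocol G s m ω τ} ≤
      ENNReal.ofReal ((Fintype.card V : ℝ) ^ (-a)) := by
  set n := Fintype.card V with hn_def
  have hn : (n : ℝ) ≠ 0 := Nat.cast_ne_zero.2 (Fintype.card_pos_iff.2 ⟨s⟩).ne'
  have hDb : D < 4 ^ b := by
    have : (0 : ℝ) < 4 ^ b := by positivity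
    have : (D : ℝ) < 4 ^ b := by
      linarith [mul_le_four_pow (mul_timeScale_le_of_one_le ha hb)]
    exact_mod_cast this
  have hsub : {ω | ¬ CompletedWithin backoffProtocol G s m ω τ} ⊆
      ⋃ v, {ω | v ∉ phaseSet G s b ω (3 * 4 ^ b)} := fun ω hω => by
    by_contra hall
    simp only [Set.mem_iUnion, Set.mem_ofPred_eq, not_exists, not_not] at hall
    exact hω (completedWithin_of_phaseSet (dist_ne_top_of_eccentricity_le hD)
      (fun v => (hopDist_le_of_eccentricity_le hD v).trans_lt hDb) hτ hall)
  calc randomness backoffProtocol V {ω | ¬ CompletedWithin backoffProtocol G s m ω τ}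
      ≤ ∑ v, randomness backoffProtocol V {ω | v ∉ phaseSet G s b ω (3 * 4 ^ b)} :=
        (measure_mono hsub).trans (measure_iUnion_fintype_le _ _)
    _ ≤ ∑ _v : V, ENNReal.ofReal ((n : ℝ) ^ (-(a + 1))) :=
        Finset.sum_le_sum fun v _ => measure_notMem_phaseSet_le_rpow hD ha hb v
    _ = ENNReal.ofReal (n * (n : ℝ) ^ (-(a + 1))) := by
        rw [Finset.sum_const, Finset.card_univ, nsmul_eq_mul, ← hn_def,
          ENNReal.ofReal_mul n.cast_nonneg, ENNReal.ofReal_natCast]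
    _ = ENNReal.ofReal ((n : ℝ) ^ (-a)) := by
        rw [neg_add, ← sub_eq_add_neg, Real.rpow_sub_one hn, mul_div_cancel₀ _ hn]

lemma exists_le_four_pow {B : ℝ} (hB : 1 ≤ B) :
    ∃ b : ℕ, B ≤ 4 ^ b ∧ (4 : ℝ) ^ (b + 1) ≤ 16 * B := by
  obtain ⟨b, hle, hlt⟩ := exists_nat_pow_near hB (by norm_num : (1 : ℝ) < 4)
  refine ⟨b + 1, hlt.le, ?_⟩
  calc (4 : ℝ) ^ (b + 1 + 1) = 16 * 4 ^ b := by ring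
    _ ≤ 16 * B := by gcongr

end Completion

universe u

theorem mainTheorem2_general (c : ℝ) :
    ∃ K : ℝ, 0 < K ∧ ∀ (V : Type u) [Fintype V] (G : Digraph V) (s : V) (m : BitString) (D : ℕ),
      eccentricity G s ≤ D →
        randomness backoffProtocol V
          {ω | ¬ CompletedWithin backoffProtocol G s m ω (K * timeScale (Fintype.card V) D)} ≤
            ENNReal.ofReal ((Fintype.card V : ℝ) ^ (-c)) := by
  set a := max c 1
  have ha : 1 ≤ a := le_max_right c 1
  refine ⟨16 * (10 ^ 20 * a ^ 2), by positivity, fun V _ G s m D hD => ?_⟩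
  have hn : (1 : ℝ) ≤ Fintype.card V := Nat.one_le_cast.2 (Fintype.card_pos_iff.2 ⟨s⟩)
  have hB : 1 ≤ (10 : ℝ) ^ 20 * a ^ 2 * timeScale (Fintype.card V) D := by
    nlinarith [one_le_timeScale (Fintype.card V) D]
  obtain ⟨b, hb, hb_le⟩ := exists_le_four_pow hB
  refine (measure_not_completedWithin_le_rpow m hD ha hb ?_).trans (ENNReal.ofReal_le_ofReal
    (Real.rpow_le_rpow_of_exponent_le hn (neg_le_neg (le_max_left c 1))))
  exact hb_le.trans_eq (mul_assoc _ _ _).symm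

end RadioNetwork

open RadioNetwork in
theorem mainTheorem2 :
    ∃ (A : BlindProtocol) (K c : ℝ) (n₀ : ℕ), 0 < K ∧ 0 < c ∧
      ∀ n : ℕ, n₀ ≤ n → ∀ (G : Digraph (Fin n)) (s : Fin n) (m : BitString) (D : ℕ),
        eccentricity G s ≤ D →
          randomness A (Fin n) {ω | ¬ CompletedWithin A G s m ω (K * timeBound n D)} ≤
            ENNReal.ofReal ((n : ℝ) ^ (-c)) := by
  obtain ⟨K, hK, h⟩ := mainTheorem2_general 1
  refine ⟨backoffProtocol, K, 1, 0, hK, one_pos, fun n _ G s m D hD => ?_⟩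
  have hfail := h (Fin n) G s m D hD
  rw [Fintype.card_fin] at hfail
  refine le_trans (measure_mono (Set.ofPred_subset_ofPred.2 fun ω => mt fun hω => hω.mono ?_)) hfail
  exact mul_le_mul_of_nonneg_left (timeScale_le_timeBound n D) hK.le
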